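/- Let $\ell,n,m\ge 1$ be integers and let $\mathbb K\in\{\mathbb R,\mathbb C\}$. **Systems.** Let $$\Sigma^{H}=\{(E,J,Q,B)\in\mathbb K^{\ell\times n}\times\mathbb K^{\ell\times\ell}\times\mathbb K^{\ell\times n}\times\mathbb K^{\ell\times m} : J=-J^*,\ E^*Q=Q^*E\ge 0\},$$ and let $\Sigma^{sdH}$ (respectively $\Sigma^{dH}$) be the set of quintuples $(E,J,R,Q,B)$ of matrices with $(E,J,Q,B)\in\Sigma^H$, $R\in\mathbb K^{\ell\times\ell}$ and $R=R^*\ge 0$ (respectively $R=R^*>0$). An element describes the port-Hamiltonian descriptor system $\frac{d}{dt}(Ex)=Ax+Bu$ with $A=JQ$ for $\Sigma^H$ and $A=(J-R)Q$ for $\Sigma^{sdH},\Sigma^{dH}$. **Stabilizability.** The behaviour $\mathfrak B$ of $(E,A,B)$ is the set of all pairs $(x,u)$ of locally integrable functions $x:\mathbb R\to\mathbb K^n$, $u:\mathbb R\to\mathbb K^m$ such that $Ex$ is absolutely continuous on every compact interval and $\frac{d}{dt}(Ex)=Ax+Bu$ almost everywhere. The system is * *behaviourally stabilizable* if for every $(x,u)\in\mathfrak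 B$ there is $(x_1,u_1)\in\mathfrak B$ with $(x_1,u_1)(t)=(x,u)(t)$ for all $t<0$ and $\lim_{t\to\infty}\operatorname{ess\,sup}_{\tau\ge t}\|(x_1(\tau),u_1(\tau))\|=0$; * *completely stabilizable* if for every $x^0\in\mathbb K^n$ there is $(x,u)\in\mathfrak B$ such that $x$ is continuous at $0$ with $x(0)=x^0$, and $\lim_{t\to\infty}\operatorname{ess\,sup}_{\tau\ge t}\|x(\tau)\|=0$; * *strongly stabilizable* if for every $x^0\in\mathbb K^n$ there is $(x,u)\in\mathfrak B$ with $Ex(0)=Ex^0$ and $\lim_{t\to\infty}Ex(t)=0$. **Relative genericity.** For $S,V\subseteq\mathbb R^N$, $S$ is *relative generic* in $V$ if there is an algebraic set $\mathbb V\subseteq\mathbb R^N$ (the common zero set of finitely many real polynomials) such that $S^c\cap V\subseteq\mathbb V$ and $\mathbb V^c\cap V$ is Euclidean dense in $V$. For subsets of another finite-dimensional real vector space (complex matrix spaces being regarded as real vector spaces) the notion is transported along a real-linear isomorphism with $\mathbb R^N$. **Theorem.** Let $\Sigma$ be any of $\Sigma^H$, $\Sigma^{sdH}$, $\Sigma^{dH}$,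 and let $S_{b},S_{c},S_{s}\subseteq\Sigma$ be the sets of behaviourally, completely, and strongly stabilizable systems in $\Sigma$. Then: 1. $S_b$ is relative generic in $\Sigma$ if and only if $\ell\ne n+m$; 2. $S_c$ is relative generic in $\Sigma$ if and only if $\ell<n+m$; 3. $S_s$ is relative generic in $\Sigma$ if and only if $\ell<n+m$; 4. if $\ell>n+m$, then $S_c^c$ and $S_s^c$ are relative generic in $\Sigma$; 5. if $\ell=n+m$, then each of $\Sigma\setminus S_b$, $\Sigma\setminus S_c$, $\Sigma\setminus S_s$ has nonempty interior in the relative Euclidean topology of $\Sigma$. -/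

import Mathlib

open Matrix MeasureTheory Filter Topology
open scoped ComplexOrder

namespace PortHamiltonian

/-! ### Relative genericity -/

/-- Algebraic subsets of a real coordinate space: common zero loci of finitely many polynomials. -/
def IsAlgebraicSet {N : ℕ} (A : Set (Fin N → ℝ)) : Prop :=
  ∃ (k : ℕ) (p : Fin k → MvPolynomial (Fin N) ℝ),
    A = {v | ∀ i, MvPolynomial.eval v (p i) = 0}

/-- `S` is relative generic in `V`, for subsets of the coordinate space `ℝ^N`: there is an algebraic
set `A` with `Sᶜ ∩ V ⊆ A ∩ V` and `Aᶜ ∩ V` Euclidean dense in `V`. -/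
def IsRelGenericCoord {N : ℕ} (S V : Set (Fin N → ℝ)) : Prop :=
  ∃ A : Set (Fin N → ℝ), IsAlgebraicSet A ∧ Sᶜ ∩ V ⊆ A ∩ V ∧ V ⊆ closure (Aᶜ ∩ V)

/-- Relative genericity in a finite-dimensional real vector space `W` (in particular in spaces of
tuples of real or of complex matrices, the latter regarded as real vector spaces), by means of a
real-linear isomorphism onto a coordinate space. As such isomorphisms differ by an invertible linear
substitution of the coordinates, the notion does not depend on the isomorphism. -/
def IsRelGeneric {W : Type*} [AddCommGroup W] [Module ℝ W] (S V : Set W) : Prop :=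
  ∃ (N : ℕ) (φ : W ≃ₗ[ℝ] (Fin N → ℝ)), IsRelGenericCoord (φ '' S) (φ '' V)

/-- The subset `T ∩ V` of `V` has nonempty interior in the relative topology of `V`. -/
def HasNonemptyRelInterior {W : Type*} [TopologicalSpace W] (T V : Set W) : Prop :=
  (interior {v : V | (v : W) ∈ T}).Nonempty

variable {𝕜 : Type*} [RCLike 𝕜] {ℓ n m : ℕ}

/-! ### Descriptor systems `d/dt (E x) = A x + B u` -/

/-- The behaviour: pairs `(x, u)` of locally integrable functions on `ℝ` such that `E x` is (locally)
absolutely continuous and `d/dt (E x) = A x + B u` almost everywhere. -/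
def behaviour (E A : Matrix (Fin ℓ) (Fin n) 𝕜) (B : Matrix (Fin ℓ) (Fin m) 𝕜) :
    Set ((ℝ → Fin n → 𝕜) × (ℝ → Fin m → 𝕜)) :=
  {w | LocallyIntegrable w.1 ∧ LocallyIntegrable w.2 ∧
    (∀ a b : ℝ, AbsolutelyContinuousOnInterval (fun t => E *ᵥ w.1 t) a b) ∧
    ∀ᵐ t : ℝ, HasDerivAt (fun s => E *ᵥ w.1 s) (A *ᵥ w.1 t + B *ᵥ w.2 t) t}

/-- `lim_{t → ∞} ess sup_{τ ≥ t} ‖f τ‖ = 0`. -/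
def EssTendstoZero {F : Type*} [NormedAddCommGroup F] (f : ℝ → F) : Prop :=
  Tendsto (fun t : ℝ => essSup (fun τ => ‖f τ‖ₑ) (volume.restrict (Set.Ici t))) atTop (𝓝 0)

/-- Behavioural stabilizability: every past of a trajectory is the past of a trajectory that
tends to zero. -/
def BehaviourallyStabilizable (E A : Matrix (Fin ℓ) (Fin n) 𝕜) (B : Matrix (Fin ℓ) (Fin m) 𝕜) :
    Prop :=
  ∀ w ∈ behaviour E A B, ∃ w₁ ∈ behaviour E A B,
    (∀ t < 0, w.1 t = w₁.1 t ∧ w.2 t = w₁.2 t) ∧ EssTendstoZero (fun τ => (w₁.1 τ, w₁.2 τ))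

/-- Complete stabilizability: from every initial state the state can be steered to zero.
The state is only locally integrable, so its value at the single time `0` is meaningful only together
with continuity there; without that requirement the component of `x 0` in the kernel of `E` could be
changed at will on a null set. -/
def CompletelyStabilizable (E A : Matrix (Fin ℓ) (Fin n) 𝕜) (B : Matrix (Fin ℓ) (Fin m) 𝕜) :
    Prop :=
  ∀ x₀ : Fin n → 𝕜, ∃ w ∈ behaviour E A B,
    (ContinuousAt w.1 0 ∧ w.1 0 = x₀) ∧ EssTendstoZero w.1

/-- Strong stabilizability: from every initial value of `E x`, this quantity can be steered to
zero. -/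
def StronglyStabilizable (E A : Matrix (Fin ℓ) (Fin n) 𝕜) (B : Matrix (Fin ℓ) (Fin m) 𝕜) :
    Prop :=
  ∀ x₀ : Fin n → 𝕜, ∃ w ∈ behaviour E A B,
    E *ᵥ w.1 0 = E *ᵥ x₀ ∧ Tendsto (fun t => E *ᵥ w.1 t) atTop (𝓝 0)

/-! ### Port-Hamiltonian descriptor systems `d/dt (E x) = (J - R) Q x + B u` -/

/-- Quadruples `(E, J, Q, B)`. -/
abbrev Quadruple (𝕜 : Type*) (ℓ n m : ℕ) : Type _ :=
  Matrix (Fin ℓ) (Fin n) 𝕜 × Matrix (Fin ℓ) (Fin ℓ) 𝕜 × Matrix (Fin ℓ) (Fin n) 𝕜 ×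
    Matrix (Fin ℓ) (Fin m) 𝕜

/-- Quintuples `(E, J, R, Q, B)`. -/
abbrev Quintuple (𝕜 : Type*) (ℓ n m : ℕ) : Type _ :=
  Matrix (Fin ℓ) (Fin n) 𝕜 × Matrix (Fin ℓ) (Fin ℓ) 𝕜 × Matrix (Fin ℓ) (Fin ℓ) 𝕜 ×
    Matrix (Fin ℓ) (Fin n) 𝕜 × Matrix (Fin ℓ) (Fin m) 𝕜

/-- Conservative port-Hamiltonian systems: `J = -Jᴴ`, `Eᴴ Q = Qᴴ E ≥ 0`. -/
def SigmaH (𝕜 : Type*) [RCLike 𝕜] (ℓ n m : ℕ) : Set (Quadruple 𝕜 ℓ n m) :=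
  {(E, J, Q, _) | J = -Jᴴ ∧ Eᴴ * Q = Qᴴ * E ∧ (Eᴴ * Q).PosSemidef}

/-- Semi-dissipative port-Hamiltonian systems: in addition `R = Rᴴ ≥ 0`. -/
def SigmaSDH (𝕜 : Type*) [RCLike 𝕜] (ℓ n m : ℕ) : Set (Quintuple 𝕜 ℓ n m) :=
  {(E, J, R, Q, _) | J = -Jᴴ ∧ R.PosSemidef ∧ Eᴴ * Q = Qᴴ * E ∧ (Eᴴ * Q).PosSemidef}

/-- Dissipative port-Hamiltonian systems: in addition `R = Rᴴ > 0`. -/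
def SigmaDH (𝕜 : Type*) [RCLike 𝕜] (ℓ n m : ℕ) : Set (Quintuple 𝕜 ℓ n m) :=
  {(E, J, R, Q, _) | J = -Jᴴ ∧ R.PosDef ∧ Eᴴ * Q = Qᴴ * E ∧ (Eᴴ * Q).PosSemidef}

/-- A property of descriptor systems `(E, A, B)` with the present dimensions. -/
abbrev SystemProperty (𝕜 : Type*) (ℓ n m : ℕ) : Type _ :=
  Matrix (Fin ℓ) (Fin n) 𝕜 → Matrix (Fin ℓ) (Fin n) 𝕜 → Matrix (Fin ℓ) (Fin m) 𝕜 → Prop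

/-- The conservative systems such that `(E, J Q, B)` has the property `P`. -/
def setH (P : SystemProperty 𝕜 ℓ n m) : Set (Quadruple 𝕜 ℓ n m) :=
  {s | s ∈ SigmaH 𝕜 ℓ n m ∧ match s with | (E, J, Q, B) => P E (J * Q) B}

/-- The semi-dissipative systems such that `(E, (J - R) Q, B)` has the property `P`. -/
def setSDH (P : SystemProperty 𝕜 ℓ n m) : Set (Quintuple 𝕜 ℓ n m) :=
  {s | s ∈ SigmaSDH 𝕜 ℓ n m ∧ match s with | (E, J, R, Q, B) => P E ((J - R) * Q) B}

/-- The dissipative systems such that `(E, (J - R) Q, B)` has the property `P`. -/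
def setDH (P : SystemProperty 𝕜 ℓ n m) : Set (Quintuple 𝕜 ℓ n m) :=
  {s | s ∈ SigmaDH 𝕜 ℓ n m ∧ match s with | (E, J, R, Q, B) => P E ((J - R) * Q) B}

end PortHamiltonian

open PortHamiltonian

namespace PortHamiltonian

/-! ### Absolutely continuous vector-valued functions -/

section AbsolutelyContinuous

variable {F G : Type*} [NormedAddCommGroup F] [NormedSpace ℝ F]
  [NormedAddCommGroup G] [NormedSpace ℝ G]

/-! The shape of the pencil `[s E - A, -B]`, which has `ℓ` rows and `n + m` columns, decides
everything.

If `ℓ < n + m`, the equation `s E x(s) = A x(s) + B u(s)` generically has so many polynomial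
solutions that every vector `ξ` occurs as a coefficient of some `x(s)` (`HasStateChains`). Reading
`s` as `d/dt` and applying the solution to a scalar function with a prescribed jet at `0` that
vanishes for `t ≥ 2` gives a trajectory through `ξ` that is zero from time `2` on. Hence all three
kinds of stabilizability hold.

If `ℓ > n + m`, the pencil generically has a polynomial left inverse (`HasRowChains`). Integration
by parts against test functions then shows that every trajectory is zero almost everywhere.
Behavioural stabilizability becomes trivial, while the other two notions fail.

If `ℓ = n + m` and `[E, B]` is invertible, the upper block `L` of the inverse satisfies `L E = 1`
and `L B = 0`, so `x` obeys `ẋ = L A x` whatever the input is. A positive real part of the trace of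
`L A` forces an unstable mode. This is an open condition, and a suitable `B` realizes it.

For genericity, both chain conditions follow from surjectivity of a linear map that depends
polynomially on the system, and `exists_polyFun_surjective` certifies this by one determinant. It is
nonzero at an explicit reference system (`stateMap_reference_surjective`,
`rowMap_reference_surjective`). The constraint `Eᴴ Q ≥ 0` is not convex, so nonvanishing is spread
over the family along curves: systems with `Q = S E`, `S ≥ 0`, are dense
(`exists_posSemidef_mul_eq`), and moving `E` and `S` on segments gives a quadratic curve inside the
family that ends at the reference system (`curve_posSemidef`). A one-variable polynomial that is
nonzero at the end of the curve has only finitely many zeros on it (`subset_closure_of_curves`).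
`genericity_of_family` combines the three cases. -/

theorem ac_clm_comp {f : ℝ → F} {a b : ℝ} (hf : AbsolutelyContinuousOnInterval f a b)
    (L : F →L[ℝ] G) : AbsolutelyContinuousOnInterval (fun t => L (f t)) a b := by
  unfold AbsolutelyContinuousOnInterval at hf ⊢
  refine squeeze_zero (fun t => Finset.sum_nonneg fun i _ => dist_nonneg) (fun t => ?_)
    (by simpa using hf.const_mul ‖L‖)
  rw [Finset.mul_sum]
  refine Finset.sum_le_sum fun i _ => ?_
  exact L.lipschitz.dist_le_mul _ _

theorem ac_sum {ι : Type*} (s : Finset ι) {f : ι → ℝ → F} {a b : ℝ}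
    (hf : ∀ i ∈ s, AbsolutelyContinuousOnInterval (f i) a b) :
    AbsolutelyContinuousOnInterval (fun t => ∑ i ∈ s, f i t) a b := by
  classical
  induction s using Finset.induction_on with
  | empty => simpa using (contDiffOn_const (c := (0 : F))).absolutelyContinuousOnInterval
  | insert i s hi ih =>
    simp only [Finset.sum_insert hi]
    exact (hf i (by simp)).fun_add (ih fun j hj => hf j (by simp [hj]))

/-- Continuous functionals separate points, so the fundamental theorem of calculus for scalar
absolutely continuous functions suffices. -/
theorem integral_eq_sub_of_ac {f g : ℝ → F} {a b : ℝ} [CompleteSpace F]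
    (hf : AbsolutelyContinuousOnInterval f a b)
    (hd : ∀ᵐ t : ℝ, HasDerivAt f (g t) t) (hg : IntervalIntegrable g volume a b) :
    ∫ t in a..b, g t = f b - f a := by
  rw [SeparatingDual.eq_iff_forall_dual_eq (R := ℝ)]
  intro L
  rw [← L.intervalIntegral_comp_comm hg, map_sub, ← (ac_clm_comp hf L).integral_deriv_eq_sub]
  refine intervalIntegral.integral_congr_ae ?_
  filter_upwards [hd] with t ht _
  exact ((L.hasFDerivAt.comp_hasDerivAt t ht).deriv).symm

/-- A map of the line contracting intervals preserves absolute continuity. -/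
theorem ac_comp_of_contracting {X : Type*} [PseudoMetricSpace X] {f : ℝ → X} {r : ℝ → ℝ}
    (hf : ∀ a b, AbsolutelyContinuousOnInterval f a b)
    (hr : ∀ s t, dist (r s) (r t) ≤ dist s t)
    (hI : ∀ s t, Set.uIoc (r s) (r t) ⊆ Set.uIoc s t) (hm : Monotone r) (a b : ℝ) :
    AbsolutelyContinuousOnInterval (fun t => f (r t)) a b := by
  rw [absolutelyContinuousOnInterval_iff]
  intro ε hε
  obtain ⟨δ, hδ, h⟩ := (absolutelyContinuousOnInterval_iff _ _ _).1 (hf (r a) (r b)) ε hε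
  refine ⟨δ, hδ, fun E hE hlen => ?_⟩
  refine h (E.1, fun i => (r (E.2 i).1, r (E.2 i).2)) ⟨fun i hi => ?_, ?_⟩ ?_
  · have := hE.1 i hi
    refine ⟨?_, ?_⟩
    · rcases le_total a b with h | h
      · rw [Set.uIcc_of_le h] at this
        rw [Set.uIcc_of_le (hm h)]
        exact ⟨hm this.1.1, hm this.1.2⟩
      · rw [Set.uIcc_of_ge h] at this
        rw [Set.uIcc_of_ge (hm h)]
        exact ⟨hm this.1.1, hm this.1.2⟩
    · rcases le_total a b with h | h
      · rw [Set.uIcc_of_le h] at this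
        rw [Set.uIcc_of_le (hm h)]
        exact ⟨hm this.2.1, hm this.2.2⟩
      · rw [Set.uIcc_of_ge h] at this
        rw [Set.uIcc_of_ge (hm h)]
        exact ⟨hm this.2.1, hm this.2.2⟩
  · intro i hi j hj hij
    exact (hE.2 hi hj hij).mono (hI _ _) (hI _ _)
  · exact lt_of_le_of_lt (Finset.sum_le_sum fun i _ => hr _ _) hlen

/-- The glued function equals `f (min t 0) + g (max t 0) - f 0`, and both clamping maps contract
intervals while keeping disjoint ones disjoint. -/
theorem ac_ite_lt_zero {f g : ℝ → F} (hf : ∀ a b, AbsolutelyContinuousOnInterval f a b)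
    (hg : ∀ a b, AbsolutelyContinuousOnInterval g a b) (h0 : f 0 = g 0) (a b : ℝ) :
    AbsolutelyContinuousOnInterval (fun t => if t < 0 then f t else g t) a b := by
  have h1 := ac_comp_of_contracting (r := fun t => min t 0) hf
    (fun s t => by simpa [Real.dist_eq] using abs_min_sub_min_le_max s 0 t 0)
    (fun s t x => by
      simp only [Set.mem_uIoc]
      grind) (fun s t h => min_le_min_right 0 h) a b
  have h2 := ac_comp_of_contracting (r := fun t => max t 0) hg
    (fun s t => by simpa [Real.dist_eq] using abs_max_sub_max_le_max s 0 t 0)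
    (fun s t x => by
      simp only [Set.mem_uIoc]
      grind) (fun s t h => max_le_max_right 0 h) a b
  have h3 : AbsolutelyContinuousOnInterval (fun _ : ℝ => f 0) a b :=
    (contDiffOn_const).absolutelyContinuousOnInterval
  convert (h1.fun_add h2).fun_sub h3 using 2 with t
  split_ifs with ht
  · simp [min_eq_left ht.le, max_eq_right ht.le, h0]
  · simp [min_eq_right (not_lt.1 ht), max_eq_left (not_lt.1 ht)]

end AbsolutelyContinuous

/-! ### Essential convergence to zero -/

theorem essTendstoZero_of_ae_eq_zero {F : Type*} [NormedAddCommGroup F] {f : ℝ → F} (T : ℝ)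
    (h : ∀ᵐ τ : ℝ, T ≤ τ → f τ = 0) : EssTendstoZero f := by
  refine tendsto_const_nhds.congr' ?_
  filter_upwards [eventually_ge_atTop T] with t ht
  symm
  refine ENNReal.essSup_eq_zero_iff.2 ?_
  rw [Filter.EventuallyEq, ae_restrict_iff' measurableSet_Ici]
  filter_upwards [h] with τ hτ hτt
  simp [hτ (ht.trans hτt)]

theorem EssTendstoZero.exists_norm_lt {F : Type*} [NormedAddCommGroup F] {f : ℝ → F}
    (h : EssTendstoZero f) {ε : ℝ} (hε : 0 < ε) (T : ℝ) : ∃ τ ≥ T, ‖f τ‖ < ε := by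
  have h1 : ∀ᶠ t in atTop,
      essSup (fun τ => ‖f τ‖ₑ) (volume.restrict (Set.Ici t)) < ENNReal.ofReal ε :=
    h.eventually_lt_const (by simpa using hε)
  obtain ⟨t, ht, hT⟩ := (h1.and (eventually_ge_atTop T)).exists
  have h2 := ae_lt_of_essSup_lt ht
  have : NeZero (volume.restrict (Set.Ici t)) := ⟨by simp⟩
  rw [ae_restrict_iff' measurableSet_Ici] at h2
  have h3 : ∃ τ ∈ Set.Ici t, ‖f τ‖ₑ < ENNReal.ofReal ε := by
    by_contra! hc
    have : volume (Set.Ici t) = 0 := by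
      refine measure_mono_null ?_ (ae_iff.1 h2)
      intro τ hτ
      simpa using ⟨hτ, hc τ hτ⟩
    simp at this
  obtain ⟨τ, hτ, hlt⟩ := h3
  refine ⟨τ, hT.trans hτ, ?_⟩
  rw [← ofReal_norm] at hlt
  exact (ENNReal.ofReal_lt_ofReal_iff hε).1 hlt

end PortHamiltonian

namespace PortHamiltonian

variable {𝕜 : Type*} [RCLike 𝕜] {ℓ n m : ℕ}

/-- Multiplication by a matrix as a real continuous linear map. -/
noncomputable def mulVecCLM {p q : ℕ} (M : Matrix (Fin p) (Fin q) 𝕜) :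
    (Fin q → 𝕜) →L[ℝ] (Fin p → 𝕜) :=
  LinearMap.toContinuousLinearMap (M.mulVecLin.restrictScalars ℝ)

@[simp] theorem mulVecCLM_apply {p q : ℕ} (M : Matrix (Fin p) (Fin q) 𝕜) (v : Fin q → 𝕜) :
    mulVecCLM M v = M *ᵥ v := rfl

/-! ### Trajectories from finite chains -/

/-- Every vector is a member of a finite chain `A x₀ + B u₀ = 0`, `E xₖ = A xₖ₊₁ + B uₖ₊₁`, the
coefficient sequence of a polynomial solution of the pencil. -/
def HasStateChains (E A : Matrix (Fin ℓ) (Fin n) 𝕜) (B : Matrix (Fin ℓ) (Fin m) 𝕜) : Prop :=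
  ∀ ξ : Fin n → 𝕜, ∃ (x : ℕ → Fin n → 𝕜) (u : ℕ → Fin m → 𝕜) (N k₀ : ℕ),
    (∀ k, N ≤ k → x k = 0 ∧ u k = 0) ∧ A *ᵥ x 0 + B *ᵥ u 0 = 0 ∧
    (∀ k, E *ᵥ x k = A *ᵥ x (k + 1) + B *ᵥ u (k + 1)) ∧ x k₀ = ξ

/-- The sequence consists of the successive derivatives of a cut-off monomial `t ^ k₀ / k₀!`. -/
theorem exists_jet (k₀ : ℕ) : ∃ d : ℕ → ℝ → ℝ,
    (∀ k, ContDiff ℝ 1 (d k)) ∧ (∀ k t, HasDerivAt (d k) (d (k + 1) t) t) ∧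
    (∀ k, d k 0 = if k = k₀ then 1 else 0) ∧ (∀ k, ∀ t ≥ 2, d k t = 0) := by
  -- The bump equals `1` near `0`, so it leaves the jet of the monomial unchanged, and it vanishes
  -- for `|t| ≥ 1`, so all derivatives are zero on a neighbourhood of every `t ≥ 2`.
  let b : ContDiffBump (0 : ℝ) := ⟨1 / 2, 1, by norm_num, by norm_num⟩
  let y : ℝ → ℝ := fun t => b t * ((k₀.factorial : ℝ)⁻¹ * t ^ k₀)
  have hy : ContDiff ℝ (⊤ : ℕ∞) y := by
    have : ContDiff ℝ (⊤ : ℕ∞) b := b.contDiff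
    fun_prop
  have hk : ∀ k, ContDiff ℝ (⊤ : ℕ∞) (iteratedDeriv k y) := fun k => by
    rw [iteratedDeriv_eq_iterate]
    exact hy.iterate_deriv k
  refine ⟨fun k => iteratedDeriv k y, fun k => (hk k).of_le (by simp), fun k t => ?_,
    fun k => ?_, fun k t ht => ?_⟩
  · beta_reduce
    rw [iteratedDeriv_succ]
    exact (((hk k).differentiable (by simp)) t).hasDerivAt
  · have : y =ᶠ[𝓝 0] fun t => (k₀.factorial : ℝ)⁻¹ * t ^ k₀ := by
      filter_upwards [b.eventuallyEq_one] with t ht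
      simp [y, ht]
    beta_reduce
    rw [this.iteratedDeriv_eq, iteratedDeriv_const_mul_field, iteratedDeriv_fun_pow_zero]
    split_ifs with h
    · subst h; field_simp
    · simp
  · have : y =ᶠ[𝓝 t] fun _ => 0 := by
      filter_upwards [lt_mem_nhds (show (1 : ℝ) < t by linarith)] with s hs
      have : b s = 0 := b.zero_of_le_dist (by simpa [b, abs_of_pos (by linarith : 0 < s)] using hs.le)
      simp [y, this]
    beta_reduce
    rw [this.iteratedDeriv_eq]
    simp

theorem HasStateChains.exists_trajectory {E A : Matrix (Fin ℓ) (Fin n) 𝕜}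
    {B : Matrix (Fin ℓ) (Fin m) 𝕜} (h : HasStateChains E A B) (ξ : Fin n → 𝕜) :
    ∃ w ∈ behaviour E A B, Continuous w.1 ∧ w.1 0 = ξ ∧ ∀ t ≥ 2, w.1 t = 0 ∧ w.2 t = 0 := by
  obtain ⟨x, u, N, k₀, hN, h0, hs, rfl⟩ := h ξ
  obtain ⟨d, hd1, hd, hd0, hdT⟩ := exists_jet k₀
  -- The polynomial solution with `s ^ k` replaced by the `k`-th derivative of the scalar function.
  let X : ℝ → Fin n → 𝕜 := fun t => ∑ k ∈ Finset.range (N + 1), d k t • x k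
  let U : ℝ → Fin m → 𝕜 := fun t => ∑ k ∈ Finset.range (N + 1), d k t • u k
  have hX : ContDiff ℝ 1 X := by
    refine ContDiff.sum fun k _ => ?_
    exact (hd1 k).smul contDiff_const
  have hU : ContDiff ℝ 1 U := by
    refine ContDiff.sum fun k _ => ?_
    exact (hd1 k).smul contDiff_const
  have hEX : ∀ t, HasDerivAt (fun s => E *ᵥ X s) (A *ᵥ X t + B *ᵥ U t) t := by
    intro t
    have h1 : HasDerivAt X (∑ k ∈ Finset.range (N + 1), d (k + 1) t • x k) t := by
      refine HasDerivAt.fun_sum fun k _ => ?_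
      exact (hd k t).smul_const (x k)
    have h2 := (mulVecCLM E).hasFDerivAt.comp_hasDerivAt t h1
    refine h2.congr_deriv (Eq.symm ?_)
    simp only [X, U, mulVecCLM_apply, Matrix.mulVec_sum, Matrix.mulVec_smul]
    rw [← Finset.sum_add_distrib]
    simp only [← smul_add]
    -- The term `k = 0` of the right-hand side is `A x₀ + B u₀ = 0` and the term `k = N` of the
    -- left-hand side contains `x N = 0`; the others match after a shift by one.
    rw [Finset.sum_range_succ', h0, smul_zero, add_zero, Finset.sum_range_succ,
      (hN N le_rfl).1, mulVec_zero, smul_zero, add_zero]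
    exact Finset.sum_congr rfl fun k _ => by rw [hs k]
  refine ⟨(X, U), ⟨hX.continuous.locallyIntegrable, hU.continuous.locallyIntegrable,
    fun a b => ?_, Eventually.of_forall hEX⟩, hX.continuous, ?_, fun t ht => ?_⟩
  · have : ContDiff ℝ 1 (fun t => E *ᵥ X t) := (mulVecCLM E).contDiff.comp hX
    exact this.contDiffOn.absolutelyContinuousOnInterval
  · simp only [X, hd0]
    by_cases hk : k₀ < N + 1
    · simp [ite_smul, Finset.sum_ite_eq', hk]
    -- Here `k₀` lies beyond the end of the chain, so the prescribed state is zero.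
    · rw [(hN k₀ (by omega)).1]
      refine Finset.sum_eq_zero fun k hk' => ?_
      rw [if_neg (by rintro rfl; exact hk (Finset.mem_range.1 hk')), zero_smul]
  · simp [X, U, hdT _ t ht]

/-- Concatenation of trajectories at time zero. -/
theorem behaviour_concat {E A : Matrix (Fin ℓ) (Fin n) 𝕜} {B : Matrix (Fin ℓ) (Fin m) 𝕜}
    {w w' : (ℝ → Fin n → 𝕜) × (ℝ → Fin m → 𝕜)} (hw : w ∈ behaviour E A B)
    (hw' : w' ∈ behaviour E A B) (h0 : E *ᵥ w.1 0 = E *ᵥ w'.1 0) :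
    ((fun t => if t < 0 then w.1 t else w'.1 t, fun t => if t < 0 then w.2 t else w'.2 t) :
      (ℝ → Fin n → 𝕜) × (ℝ → Fin m → 𝕜)) ∈ behaviour E A B := by
  have hloc : ∀ {p : ℕ} {f g : ℝ → Fin p → 𝕜}, LocallyIntegrable f → LocallyIntegrable g →
      LocallyIntegrable (fun t : ℝ => if t < 0 then f t else g t) := by
    intro p f g hf hg
    refine ((hf.indicator (measurableSet_Iio (a := (0 : ℝ)))).add
      (hg.indicator (measurableSet_Ici (a := (0 : ℝ))))).congr (Eventually.of_forall fun t => ?_)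
    by_cases ht : t < 0
    · simp [ht, Set.indicator, not_le.2 ht]
    · simp [ht, Set.indicator, not_lt.1 ht]
  have hE : (fun t => E *ᵥ (if t < 0 then w.1 t else w'.1 t)) =
      fun t => if t < 0 then E *ᵥ w.1 t else E *ᵥ w'.1 t := by
    ext1 t; split_ifs <;> rfl
  refine ⟨hloc hw.1 hw'.1, hloc hw.2.1 hw'.2.1, fun a b => ?_, ?_⟩
  · simp only [hE]
    exact ac_ite_lt_zero hw.2.2.1 hw'.2.2.1 h0 a b
  · have hne : ∀ᵐ t : ℝ, t ≠ 0 := by simp [ae_iff]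
    filter_upwards [hw.2.2.2, hw'.2.2.2, hne] with t h1 h2 ht
    simp only [hE]
    rcases lt_or_gt_of_ne ht with ht | ht
    · rw [if_pos ht, if_pos ht]
      refine h1.congr_of_eventuallyEq ?_
      filter_upwards [gt_mem_nhds ht] with s hs
      rw [if_pos hs]
    · rw [if_neg ht.not_gt, if_neg ht.not_gt]
      refine h2.congr_of_eventuallyEq ?_
      filter_upwards [lt_mem_nhds ht] with s hs
      rw [if_neg hs.not_gt]

theorem HasStateChains.behaviourallyStabilizable {E A : Matrix (Fin ℓ) (Fin n) 𝕜}
    {B : Matrix (Fin ℓ) (Fin m) 𝕜} (h : HasStateChains E A B) :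
    BehaviourallyStabilizable E A B := by
  intro w hw
  obtain ⟨w', hw', -, h0, hT⟩ := h.exists_trajectory (w.1 0)
  refine ⟨_, behaviour_concat hw hw' (by rw [h0]), fun t ht => by simp [ht], ?_⟩
  refine essTendstoZero_of_ae_eq_zero 2 (Eventually.of_forall fun τ hτ => ?_)
  have : ¬ τ < 0 := by linarith
  simp [this, hT τ hτ]

theorem HasStateChains.completelyStabilizable {E A : Matrix (Fin ℓ) (Fin n) 𝕜}
    {B : Matrix (Fin ℓ) (Fin m) 𝕜} (h : HasStateChains E A B) :
    CompletelyStabilizable E A B := by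
  intro ξ
  obtain ⟨w', hw', hc, h0, hT⟩ := h.exists_trajectory ξ
  exact ⟨w', hw', ⟨hc.continuousAt, h0⟩,
    essTendstoZero_of_ae_eq_zero 2 (Eventually.of_forall fun τ hτ => (hT τ hτ).1)⟩

theorem HasStateChains.stronglyStabilizable {E A : Matrix (Fin ℓ) (Fin n) 𝕜}
    {B : Matrix (Fin ℓ) (Fin m) 𝕜} (h : HasStateChains E A B) :
    StronglyStabilizable E A B := by
  intro ξ
  obtain ⟨w', hw', hc, h0, hT⟩ := h.exists_trajectory ξ
  refine ⟨w', hw', by rw [h0], tendsto_const_nhds.congr' ?_⟩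
  filter_upwards [eventually_ge_atTop 2] with t ht
  rw [(hT t ht).1, mulVec_zero]

/-! ### Systems without nonzero trajectories -/

/-- Every pair of rows `(p, q)` is a polynomial combination of the rows of the pencil
`[s E - A, B]`; the sequence `y` is the coefficient sequence of the combination. -/
def HasRowChains (E A : Matrix (Fin ℓ) (Fin n) 𝕜) (B : Matrix (Fin ℓ) (Fin m) 𝕜) : Prop :=
  ∀ (p : Fin n → 𝕜) (q : Fin m → 𝕜), ∃ (y : ℕ → Fin ℓ → 𝕜) (N : ℕ),
    (∀ k, N ≤ k → y k = 0) ∧ y 0 ᵥ* A = -p ∧ y 0 ᵥ* B = q ∧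
    (∀ k, y k ᵥ* E = y (k + 1) ᵥ* A) ∧ ∀ k, y (k + 1) ᵥ* B = 0

/-- The chain is a polynomial row with `y(s) (s E - A) = p` and `y(s) B = q`. Applying it to the
differential equation in the weak sense moves all derivatives onto the test function, and what
remains is `q u - p x = 0`. -/
theorem HasRowChains.ae_dotProduct_eq {E A : Matrix (Fin ℓ) (Fin n) 𝕜}
    {B : Matrix (Fin ℓ) (Fin m) 𝕜} (h : HasRowChains E A B)
    {w : (ℝ → Fin n → 𝕜) × (ℝ → Fin m → 𝕜)} (hw : w ∈ behaviour E A B)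
    (p : Fin n → 𝕜) (q : Fin m → 𝕜) : ∀ᵐ t : ℝ, q ⬝ᵥ w.2 t - p ⬝ᵥ w.1 t = 0 := by
  obtain ⟨y, N, hN, hp, hq, hE, hB⟩ := h p q
  let D : ∀ {r : ℕ} (_ : Fin r → 𝕜), (Fin r → 𝕜) →L[ℝ] 𝕜 := fun {r} v =>
    LinearMap.toContinuousLinearMap ((dotProductBilin 𝕜 𝕜 v).restrictScalars ℝ)
  have hD : ∀ {r : ℕ} (v x : Fin r → 𝕜), D v x = v ⬝ᵥ x := fun v x => rfl
  have hDint : ∀ {r : ℕ} (v : Fin r → 𝕜) {f : ℝ → Fin r → 𝕜}, LocallyIntegrable f →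
      LocallyIntegrable (fun t => v ⬝ᵥ f t) := fun v f hf => by
    rw [← locallyIntegrableOn_univ] at hf ⊢
    exact (D v).locallyIntegrableOn_comp hf
  refine ae_eq_zero_of_integral_contDiff_smul_eq_zero ((hDint q hw.2.1).sub (hDint p hw.1)) ?_
  intro φ hφ hφc
  -- The signs are those of repeated integration by parts, so the derivative of `d k` is `-d (k +
  -- 1)`.
  let d : ℕ → ℝ → ℝ := fun k t => (-1) ^ k * iteratedDeriv k φ t
  have hk : ∀ k, ContDiff ℝ (⊤ : ℕ∞) (iteratedDeriv k φ) := fun k => by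
    rw [iteratedDeriv_eq_iterate]
    exact hφ.iterate_deriv k
  have hdc : ∀ k, ContDiff ℝ 1 (d k) := fun k =>
    contDiff_const.mul ((hk k).of_le (by simp))
  have hd : ∀ k t, HasDerivAt (d k) (-d (k + 1) t) t := fun k t => by
    have := ((((hk k).differentiable (by simp)) t).hasDerivAt).const_mul ((-1 : ℝ) ^ k)
    rw [← iteratedDeriv_succ] at this
    refine this.congr_deriv ?_
    simp only [d]; ring
  obtain ⟨R, hR0, hR⟩ : ∃ R > 0, ∀ k t, R < |t| → d k t = 0 := by
    obtain ⟨R, hR0, hR⟩ := hφc.isCompact.isBounded.exists_pos_norm_le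
    refine ⟨R, hR0, fun k t ht => ?_⟩
    have h1 : φ =ᶠ[𝓝 t] fun _ => 0 :=
      notMem_tsupport_iff_eventuallyEq.1 fun hmem => absurd (hR t hmem) (not_le.2 ht)
    simp only [d]
    rw [h1.iteratedDeriv_eq]
    simp
  -- A compactly supported primitive of the tested expression: by the chain relations the
  -- derivatives of the summands telescope to `φ (q u - p x)`, whose integral is therefore zero.
  let H : ℝ → 𝕜 := fun t => ∑ k ∈ Finset.range (N + 1), d k t • (y k ⬝ᵥ (E *ᵥ w.1 t))
  have hderiv : ∀ᵐ t : ℝ, HasDerivAt H (φ t • (q ⬝ᵥ w.2 t - p ⬝ᵥ w.1 t)) t := by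
    filter_upwards [hw.2.2.2] with t ht
    have h1 : HasDerivAt H (∑ k ∈ Finset.range (N + 1),
        (d k t • (y k ⬝ᵥ (A *ᵥ w.1 t + B *ᵥ w.2 t)) +
          (-d (k + 1) t) • (y k ⬝ᵥ (E *ᵥ w.1 t)))) t := by
      refine HasDerivAt.fun_sum fun k _ => ?_
      exact (hd k t).smul ((D (y k)).hasFDerivAt.comp_hasDerivAt t ht)
    refine h1.congr_deriv ?_
    rw [Finset.sum_add_distrib, Finset.sum_range_succ', Finset.sum_range_succ _ N,
      hN N le_rfl, zero_dotProduct, smul_zero, add_zero, add_right_comm, ← Finset.sum_add_distrib,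
      Finset.sum_eq_zero, zero_add]
    · simp [d, dotProduct_add, dotProduct_mulVec, hp, hq, smul_sub]
      ring
    · intro k _
      simp [dotProduct_add, dotProduct_mulVec, hE, hB]
  have hAC : AbsolutelyContinuousOnInterval H (-(R + 1)) (R + 1) := by
    refine ac_sum _ fun k _ => ?_
    exact (hdc k).contDiffOn.absolutelyContinuousOnInterval.fun_smul
      (ac_clm_comp (hw.2.2.1 _ _) (D (y k)))
  have hgint : Integrable (fun t => φ t • (q ⬝ᵥ w.2 t - p ⬝ᵥ w.1 t)) :=
    ((hDint q hw.2.1).sub (hDint p hw.1)).integrable_smul_left_of_hasCompactSupport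
      hφ.continuous hφc
  have hloc := integral_eq_sub_of_ac hAC hderiv hgint.intervalIntegrable
  have hH : ∀ t, R < |t| → H t = 0 := fun t ht => by simp [H, hR _ t ht]
  rw [hH (R + 1) (by rw [abs_of_pos (by linarith)]; linarith),
    hH (-(R + 1)) (by rw [abs_neg, abs_of_pos (by linarith)]; linarith), sub_zero,
    intervalIntegral.integral_eq_integral_of_support_subset] at hloc
  · exact hloc
  · intro t ht
    by_contra hmem
    refine ht ?_
    have h1 : R < |t| := by
      by_contra hc
      have := abs_le.1 (not_lt.1 hc)
      exact hmem ⟨by linarith [this.1], by linarith [this.2]⟩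
    have h2 : φ t = 0 := by simpa [d] using hR 0 t h1
    simp [h2]

theorem HasRowChains.ae_eq_zero {E A : Matrix (Fin ℓ) (Fin n) 𝕜}
    {B : Matrix (Fin ℓ) (Fin m) 𝕜} (h : HasRowChains E A B)
    {w : (ℝ → Fin n → 𝕜) × (ℝ → Fin m → 𝕜)} (hw : w ∈ behaviour E A B) :
    ∀ᵐ t : ℝ, w.1 t = 0 ∧ w.2 t = 0 := by
  have h1 : ∀ᵐ t : ℝ, ∀ i, w.1 t i = 0 := by
    refine ae_all_iff.2 fun i => ?_
    filter_upwards [h.ae_dotProduct_eq hw (Pi.single i 1) 0] with t ht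
    simpa using ht
  have h2 : ∀ᵐ t : ℝ, ∀ i, w.2 t i = 0 := by
    refine ae_all_iff.2 fun i => ?_
    filter_upwards [h.ae_dotProduct_eq hw 0 (Pi.single i 1)] with t ht
    simpa using ht
  filter_upwards [h1, h2] with t h1 h2
  exact ⟨funext h1, funext h2⟩

/-- Each trajectory is almost everywhere zero and serves as its own continuation. -/
theorem HasRowChains.behaviourallyStabilizable {E A : Matrix (Fin ℓ) (Fin n) 𝕜}
    {B : Matrix (Fin ℓ) (Fin m) 𝕜} (h : HasRowChains E A B) :
    BehaviourallyStabilizable E A B := by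
  intro w hw
  refine ⟨w, hw, fun t _ => ⟨rfl, rfl⟩, essTendstoZero_of_ae_eq_zero 0 ?_⟩
  filter_upwards [h.ae_eq_zero hw] with t ht _
  simp [ht]

theorem eq_zero_of_ae_eq_zero_of_continuousAt {F : Type*} [NormedAddCommGroup F] {f : ℝ → F}
    {t : ℝ} (h : ∀ᵐ s : ℝ, f s = 0) (hc : ContinuousAt f t) : f t = 0 := by
  by_contra hne
  have h1 : {s | f s ≠ 0} ∈ 𝓝 t := hc.eventually_ne hne
  exact (Measure.measure_pos_of_mem_nhds volume h1).ne' (ae_iff.1 h)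

theorem HasRowChains.not_completelyStabilizable {E A : Matrix (Fin ℓ) (Fin n) 𝕜}
    {B : Matrix (Fin ℓ) (Fin m) 𝕜} (h : HasRowChains E A B) (hn : 0 < n) :
    ¬ CompletelyStabilizable E A B := by
  intro hc
  obtain ⟨w, hw, ⟨hcont, h0⟩, -⟩ := hc (Pi.single ⟨0, hn⟩ 1)
  have h1 : w.1 0 = 0 := eq_zero_of_ae_eq_zero_of_continuousAt
    ((h.ae_eq_zero hw).mono fun t ht => ht.1) hcont
  rw [h1] at h0
  simpa using congrFun h0 ⟨0, hn⟩

theorem continuous_mulVec_of_mem_behaviour {E A : Matrix (Fin ℓ) (Fin n) 𝕜}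
    {B : Matrix (Fin ℓ) (Fin m) 𝕜} {w : (ℝ → Fin n → 𝕜) × (ℝ → Fin m → 𝕜)}
    (hw : w ∈ behaviour E A B) : Continuous fun t => E *ᵥ w.1 t := by
  refine continuous_iff_continuousAt.2 fun t => ?_
  refine (hw.2.2.1 (t - 1) (t + 1)).continuousOn.continuousAt ?_
  rw [Set.uIcc_of_le (by linarith)]
  exact Icc_mem_nhds (by linarith) (by linarith)

/-- Although `x` is zero only almost everywhere, `E x` is continuous and so vanishes at `0` as well.
Strong stabilizability would then give `E x₀ = 0` for every `x₀`. -/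
theorem HasRowChains.not_stronglyStabilizable {E A : Matrix (Fin ℓ) (Fin n) 𝕜}
    {B : Matrix (Fin ℓ) (Fin m) 𝕜} (h : HasRowChains E A B) (hE : E ≠ 0) :
    ¬ StronglyStabilizable E A B := by
  intro hs
  refine hE (Matrix.ext_of_mulVec_single fun i => ?_)
  obtain ⟨w, hw, h0, -⟩ := hs (Pi.single i 1)
  rw [← h0, zero_mulVec]
  refine eq_zero_of_ae_eq_zero_of_continuousAt (f := fun t => E *ᵥ w.1 t)
    ?_ (continuous_mulVec_of_mem_behaviour hw).continuousAt
  filter_upwards [h.ae_eq_zero hw] with t ht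
  rw [ht.1, mulVec_zero]

end PortHamiltonian

namespace PortHamiltonian

variable {𝕜 : Type*} [RCLike 𝕜] {ℓ n m : ℕ}

/-! ### Unstable systems -/

/-- The embedding of a real or complex field into the complex numbers. -/
noncomputable def toComplexHom (𝕜 : Type*) [RCLike 𝕜] : 𝕜 →ₐ[ℝ] ℂ where
  toFun z := ⟨RCLike.re z, RCLike.im z⟩
  map_one' := by apply Complex.ext <;> simp
  map_mul' z w := by apply Complex.ext <;> simp
  map_zero' := by apply Complex.ext <;> simp
  map_add' z w := by apply Complex.ext <;> simp
  commutes' r := by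
    apply Complex.ext <;> simp [RCLike.algebraMap_eq_ofReal]

theorem toComplexHom_re (z : 𝕜) : (toComplexHom 𝕜 z).re = RCLike.re z := rfl

/-- The trace is the sum of the roots of the characteristic polynomial, so they cannot all have
nonpositive real part. -/
theorem exists_left_eigenvector_of_trace_pos (F : Matrix (Fin n) (Fin n) ℂ)
    (h : 0 < F.trace.re) : ∃ μ : ℂ, 0 < μ.re ∧ ∃ v : Fin n → ℂ, v ≠ 0 ∧ v ᵥ* F = μ • v := by
  have h1 : ∃ μ ∈ F.charpoly.roots, 0 < μ.re := by
    by_contra! hc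
    rw [Matrix.trace_eq_sum_roots_charpoly] at h
    refine absurd h (not_lt.2 ?_)
    have : ∀ s : Multiset ℂ, (∀ μ ∈ s, μ.re ≤ 0) → s.sum.re ≤ 0 := by
      intro s
      induction s using Multiset.induction_on with
      | empty => simp
      | cons a s ih =>
        intro hs
        have h1 := hs a (by simp)
        have h2 := ih fun μ hμ => hs μ (by simp [hμ])
        simp only [Multiset.sum_cons, Complex.add_re]
        linarith
    exact this _ hc
  obtain ⟨μ, hμ, hre⟩ := h1
  have h2 := Polynomial.isRoot_of_mem_roots hμ
  rw [Polynomial.IsRoot.def, Matrix.eval_charpoly] at h2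
  obtain ⟨v, hv, hv0⟩ := Matrix.exists_vecMul_eq_zero_iff.2 h2
  refine ⟨μ, hre, v, hv, ?_⟩
  rw [Matrix.vecMul_sub, sub_eq_zero] at hv0
  rw [← hv0]
  ext i
  simp [Matrix.scalar_apply, Matrix.vecMul_diagonal, mul_comm]

/-- A functional `Λ` on which `E x` evolves by an exponential with growing modulus. -/
theorem exists_unstable_functional {E A : Matrix (Fin ℓ) (Fin n) 𝕜}
    {B : Matrix (Fin ℓ) (Fin m) 𝕜} {L : Matrix (Fin n) (Fin ℓ) 𝕜} (hE : L * E = 1)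
    (hB : L * B = 0) (htr : 0 < RCLike.re (L * A).trace) :
    ∃ (μ : ℂ) (Λ : (Fin ℓ → 𝕜) →L[ℝ] ℂ), 0 < μ.re ∧
      (∀ x u, Λ (A *ᵥ x + B *ᵥ u) = μ * Λ (E *ᵥ x)) ∧ ∃ x₀, Λ (E *ᵥ x₀) ≠ 0 := by
  -- The matrix is mapped to `ℂ` so that eigenvalues exist also when `𝕜` is real; the trace keeps
  -- its real part.
  obtain ⟨μ, hμ, v, hv, hvF⟩ := exists_left_eigenvector_of_trace_pos
    ((L * A).map (toComplexHom 𝕜)) (by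
      rw [← toComplexHom_re] at htr
      generalize L * A = G at htr
      simpa [Matrix.trace, map_sum] using htr)
  -- The functional is `z ↦ v · L z` with `v` a left eigenvector of `L A`. It annihilates the range
  -- of `B` because `L B = 0`.
  let Λ₀ : (Fin ℓ → 𝕜) →ₗ[ℝ] ℂ :=
    ∑ i, (LinearMap.mulLeft ℝ (v i)) ∘ₗ (toComplexHom 𝕜).toLinearMap ∘ₗ
      (LinearMap.proj i) ∘ₗ (L.mulVecLin.restrictScalars ℝ)
  have hΛ : ∀ z, Λ₀ z = v ⬝ᵥ (fun i => toComplexHom 𝕜 ((L *ᵥ z) i)) := fun z => by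
    simp [Λ₀, dotProduct]
  have hmap : ∀ (M : Matrix (Fin n) (Fin n) 𝕜) (x : Fin n → 𝕜),
      (fun i => toComplexHom 𝕜 ((M *ᵥ x) i)) =
        M.map (toComplexHom 𝕜) *ᵥ (fun i => toComplexHom 𝕜 (x i)) := by
    intro M x
    ext i
    simp [Matrix.mulVec, dotProduct, map_sum]
  refine ⟨μ, LinearMap.toContinuousLinearMap Λ₀, hμ, fun x u => ?_, ?_⟩
  · simp only [LinearMap.coe_toContinuousLinearMap', hΛ]
    rw [mulVec_add, mulVec_mulVec, mulVec_mulVec, mulVec_mulVec, hB, hE, zero_mulVec, add_zero,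
      one_mulVec, hmap, dotProduct_mulVec, hvF, smul_dotProduct, smul_eq_mul]
  · obtain ⟨i, hi⟩ := Function.ne_iff.1 hv
    refine ⟨Pi.single i 1, ?_⟩
    simp only [LinearMap.coe_toContinuousLinearMap', hΛ]
    rw [mulVec_mulVec, hE, one_mulVec]
    have : (fun j => toComplexHom 𝕜 ((Pi.single i 1 : Fin n → 𝕜) j)) = Pi.single i 1 := by
      ext j
      by_cases h : j = i
      · subst h; simp
      · simp [h]
    rw [this]
    simpa using hi

/-- The product of `exp (-μ τ)` and `Λ (E x)` is absolutely continuous with derivative zero almost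
everywhere, hence constant. -/
theorem functional_eq_exp_mul {E A : Matrix (Fin ℓ) (Fin n) 𝕜}
    {B : Matrix (Fin ℓ) (Fin m) 𝕜} {μ : ℂ} {Λ : (Fin ℓ → 𝕜) →L[ℝ] ℂ}
    (hΛ : ∀ x u, Λ (A *ᵥ x + B *ᵥ u) = μ * Λ (E *ᵥ x))
    {w : (ℝ → Fin n → 𝕜) × (ℝ → Fin m → 𝕜)} (hw : w ∈ behaviour E A B) (s t : ℝ) :
    Λ (E *ᵥ w.1 t) = Complex.exp (μ * (t - s)) * Λ (E *ᵥ w.1 s) := by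
  let e : ℝ → ℂ := fun τ => Complex.exp (-(μ * τ))
  have he : ∀ τ, HasDerivAt e (-μ * e τ) τ := fun τ => by
    have h1 : HasDerivAt (fun τ : ℝ => -(μ * (τ : ℂ))) (-(μ * 1)) τ :=
      ((Complex.ofRealCLM.hasDerivAt (x := τ)).const_mul μ).neg
    have := h1.cexp
    refine this.congr_deriv ?_
    simp only [e]; ring
  have hec : ContDiff ℝ 1 e := by
    refine Complex.contDiff_exp.comp ?_
    exact (contDiff_const.mul Complex.ofRealCLM.contDiff).neg
  have hac : AbsolutelyContinuousOnInterval (fun τ => e τ • Λ (E *ᵥ w.1 τ)) s t :=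
    hec.contDiffOn.absolutelyContinuousOnInterval.fun_smul (ac_clm_comp (hw.2.2.1 s t) Λ)
  obtain ⟨C, hC⟩ := hac.const_of_ae_hasDerivAt_zero (by
    filter_upwards [hw.2.2.2] with τ hτ _
    have h1 := (he τ).smul (Λ.hasFDerivAt.comp_hasDerivAt τ hτ)
    refine h1.congr_deriv ?_
    simp only [Function.comp, hΛ, smul_eq_mul]
    ring)
  have h1 := (hC s Set.left_mem_uIcc).trans (hC t Set.right_mem_uIcc).symm
  simp only [e, smul_eq_mul] at h1
  have h2 : Complex.exp (μ * (t - s)) = Complex.exp (μ * t) * Complex.exp (-(μ * s)) := by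
    rw [← Complex.exp_add]; ring_nf
  rw [h2, mul_assoc, h1, ← mul_assoc, ← Complex.exp_add]
  simp

theorem norm_functional_le {E A : Matrix (Fin ℓ) (Fin n) 𝕜}
    {B : Matrix (Fin ℓ) (Fin m) 𝕜} {μ : ℂ} {Λ : (Fin ℓ → 𝕜) →L[ℝ] ℂ} (hμ : 0 < μ.re)
    (hΛ : ∀ x u, Λ (A *ᵥ x + B *ᵥ u) = μ * Λ (E *ᵥ x))
    {w : (ℝ → Fin n → 𝕜) × (ℝ → Fin m → 𝕜)} (hw : w ∈ behaviour E A B) {s t : ℝ} (hst : s ≤ t) :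
    ‖Λ (E *ᵥ w.1 s)‖ ≤ ‖Λ (E *ᵥ w.1 t)‖ := by
  rw [functional_eq_exp_mul hΛ hw s t, norm_mul, Complex.norm_exp]
  refine le_mul_of_one_le_left (norm_nonneg _) (Real.one_le_exp ?_)
  have : (μ * ((t : ℂ) - s)).re = μ.re * (t - s) := by simp
  rw [this]
  exact mul_nonneg hμ.le (sub_nonneg.2 hst)

/-- After time `s` the modulus of `Λ (E x)` never drops below its value at `s`, whereas it is
bounded by a constant times the norm of `x`. -/
theorem not_essTendstoZero_of_functional_ne_zero {E A : Matrix (Fin ℓ) (Fin n) 𝕜}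
    {B : Matrix (Fin ℓ) (Fin m) 𝕜} {μ : ℂ} {Λ : (Fin ℓ → 𝕜) →L[ℝ] ℂ} (hμ : 0 < μ.re)
    (hΛ : ∀ x u, Λ (A *ᵥ x + B *ᵥ u) = μ * Λ (E *ᵥ x))
    {w : (ℝ → Fin n → 𝕜) × (ℝ → Fin m → 𝕜)} (hw : w ∈ behaviour E A B) {s : ℝ}
    (hs : Λ (E *ᵥ w.1 s) ≠ 0) : ¬ EssTendstoZero w.1 := by
  intro h
  set c := ‖Λ (E *ᵥ w.1 s)‖
  have hc : 0 < c := norm_pos_iff.2 hs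
  set K := ‖Λ.comp (mulVecCLM E)‖
  have hK : 0 ≤ K := norm_nonneg _
  obtain ⟨τ, hτ, hlt⟩ := h.exists_norm_lt (ε := c / (K + 1)) (by positivity) s
  have h1 := norm_functional_le hμ hΛ hw hτ
  have h2 : ‖Λ (E *ᵥ w.1 τ)‖ ≤ K * ‖w.1 τ‖ := (Λ.comp (mulVecCLM E)).le_opNorm _
  rw [lt_div_iff₀ (by positivity)] at hlt
  nlinarith [norm_nonneg (w.1 τ)]

theorem not_completelyStabilizable_of_trace_pos {E A : Matrix (Fin ℓ) (Fin n) 𝕜}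
    {B : Matrix (Fin ℓ) (Fin m) 𝕜} {L : Matrix (Fin n) (Fin ℓ) 𝕜} (hE : L * E = 1)
    (hB : L * B = 0) (htr : 0 < RCLike.re (L * A).trace) : ¬ CompletelyStabilizable E A B := by
  obtain ⟨μ, Λ, hμ, hΛ, x₀, hx₀⟩ := exists_unstable_functional hE hB htr
  intro h
  obtain ⟨w, hw, ⟨-, h0⟩, hess⟩ := h x₀
  exact not_essTendstoZero_of_functional_ne_zero hμ hΛ hw (s := 0) (by rwa [h0]) hess

theorem not_stronglyStabilizable_of_trace_pos {E A : Matrix (Fin ℓ) (Fin n) 𝕜}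
    {B : Matrix (Fin ℓ) (Fin m) 𝕜} {L : Matrix (Fin n) (Fin ℓ) 𝕜} (hE : L * E = 1)
    (hB : L * B = 0) (htr : 0 < RCLike.re (L * A).trace) : ¬ StronglyStabilizable E A B := by
  obtain ⟨μ, Λ, hμ, hΛ, x₀, hx₀⟩ := exists_unstable_functional hE hB htr
  intro h
  obtain ⟨w, hw, h0, hlim⟩ := h x₀
  have h1 : Tendsto (fun t => ‖Λ (E *ᵥ w.1 t)‖) atTop (𝓝 0) := by
    simpa using ((Λ.continuous.tendsto 0).comp hlim).norm
  have h2 : ‖Λ (E *ᵥ x₀)‖ ≤ 0 := by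
    refine ge_of_tendsto h1 ?_
    filter_upwards [eventually_ge_atTop 0] with t ht
    rw [← h0]
    exact norm_functional_le hμ hΛ hw ht
  exact hx₀ (norm_le_zero_iff.1 h2)

open scoped Matrix.Norms.Operator in
theorem exists_solution (F : Matrix (Fin n) (Fin n) 𝕜) (x₀ : Fin n → 𝕜) :
    ∃ x : ℝ → Fin n → 𝕜, ContDiff ℝ 1 x ∧ x 0 = x₀ ∧ ∀ t, HasDerivAt x (F *ᵥ x t) t := by
  let X : ℝ → Matrix (Fin n) (Fin n) 𝕜 := fun t => NormedSpace.exp (t • F)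
  have hX : ∀ t, HasDerivAt X (F * X t) t := fun t => hasDerivAt_exp_smul_const' F t
  let ev : Matrix (Fin n) (Fin n) 𝕜 →L[ℝ] (Fin n → 𝕜) := LinearMap.toContinuousLinearMap
    { toFun := fun M => M *ᵥ x₀
      map_add' := fun M N => add_mulVec M N x₀
      map_smul' := fun c M => smul_mulVec c M x₀ }
  have hd : ∀ t, HasDerivAt (fun t => X t *ᵥ x₀) (F *ᵥ (X t *ᵥ x₀)) t := fun t => by
    have := ev.hasFDerivAt.comp_hasDerivAt t (hX t)
    refine this.congr_deriv ?_
    exact (mulVec_mulVec x₀ F (X t)).symm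
  refine ⟨fun t => X t *ᵥ x₀, ?_, by simp [X], hd⟩
  rw [contDiff_one_iff_deriv]
  refine ⟨fun t => (hd t).differentiableAt, ?_⟩
  have : deriv (fun t => X t *ᵥ x₀) = fun t => F *ᵥ (X t *ᵥ x₀) := funext fun t => (hd t).deriv
  rw [this]
  refine (mulVecCLM F).continuous.comp ?_
  exact continuous_iff_continuousAt.2 fun t => (hd t).continuousAt

/-- An unstable past must first be exhibited. Since `E L + B M = 1`, a solution of `ẋ = L A x` with
input `u = -M A x` is a trajectory, and `x₀` can be chosen with `Λ (E x₀) ≠ 0`. -/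
theorem not_behaviourallyStabilizable_of_trace_pos {E A : Matrix (Fin ℓ) (Fin n) 𝕜}
    {B : Matrix (Fin ℓ) (Fin m) 𝕜} {L : Matrix (Fin n) (Fin ℓ) 𝕜} {M : Matrix (Fin m) (Fin ℓ) 𝕜}
    (hE : L * E = 1) (hB : L * B = 0) (hI : E * L + B * M = 1)
    (htr : 0 < RCLike.re (L * A).trace) : ¬ BehaviourallyStabilizable E A B := by
  obtain ⟨μ, Λ, hμ, hΛ, x₀, hx₀⟩ := exists_unstable_functional hE hB htr
  intro h
  obtain ⟨x, hx, h0, hd⟩ := exists_solution (L * A) x₀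
  have hw : ((x, fun t => -((M * A) *ᵥ x t)) : (ℝ → Fin n → 𝕜) × (ℝ → Fin m → 𝕜)) ∈
      behaviour E A B := by
    refine ⟨hx.continuous.locallyIntegrable, ?_, fun a b => ?_, Eventually.of_forall fun t => ?_⟩
    · exact (((mulVecCLM (M * A)).continuous.comp hx.continuous).neg).locallyIntegrable
    · exact ((mulVecCLM E).contDiff.comp hx).contDiffOn.absolutelyContinuousOnInterval
    · have := (mulVecCLM E).hasFDerivAt.comp_hasDerivAt t (hd t)
      refine this.congr_deriv ?_
      have h1 : E * (L * A) = A - B * (M * A) := by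
        rw [← Matrix.mul_assoc, ← Matrix.mul_assoc, eq_sub_of_add_eq hI, Matrix.sub_mul,
          Matrix.one_mul]
      rw [mulVecCLM_apply, mulVec_mulVec, h1, sub_mulVec, mulVec_neg, mulVec_mulVec,
        sub_eq_add_neg]
  obtain ⟨w, hw', heq, hess⟩ := h _ hw
  -- Trajectories are compared only at negative times, so the nonzero value at `0` is carried back
  -- to `-1` by the exponential law.
  have h1 : Λ (E *ᵥ w.1 (-1)) ≠ 0 := by
    rw [← (heq (-1) (by norm_num)).1]
    have := functional_eq_exp_mul hΛ hw (-1) 0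
    simp only [h0] at this
    intro h2
    rw [h2, mul_zero] at this
    exact hx₀ this
  refine not_essTendstoZero_of_functional_ne_zero hμ hΛ hw' h1 ?_
  refine tendsto_of_tendsto_of_tendsto_of_le_of_le tendsto_const_nhds hess (fun _ => zero_le)
    fun t => essSup_mono_ae (Eventually.of_forall fun τ => ?_)
  beta_reduce
  rw [← ofReal_norm, ← ofReal_norm]
  exact ENNReal.ofReal_le_ofReal (norm_fst_le (w.1 τ, w.2 τ))

end PortHamiltonian

namespace PortHamiltonian

/-! ### Polynomial functions and genericity -/

section PolyFun

variable (𝕜 : Type*) [RCLike 𝕜] (W : Type*) [AddCommGroup W] [Module ℝ W]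

/-- The `𝕜`-valued polynomial functions on a real vector space. -/
def polyFun : Subalgebra 𝕜 (W → 𝕜) :=
  Algebra.adjoin 𝕜 (Set.range fun L : W →ₗ[ℝ] 𝕜 => (L : W → 𝕜))

variable {𝕜 W}

theorem linear_mem_polyFun (L : W →ₗ[ℝ] 𝕜) : (fun v => L v) ∈ polyFun 𝕜 W :=
  Algebra.subset_adjoin ⟨L, rfl⟩

theorem polyFun_det {ι : Type*} [Fintype ι] [DecidableEq ι] {M : W → Matrix ι ι 𝕜}
    (hM : ∀ i j, (fun v => M v i j) ∈ polyFun 𝕜 W) : (fun v => (M v).det) ∈ polyFun 𝕜 W := by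
  have : (fun v => (M v).det) =
      ∑ σ : Equiv.Perm ι, (σ.sign : ℤ) • ∏ i, fun v => M v (σ i) i := by
    ext v
    simp [Matrix.det_apply, Units.smul_def]
  rw [this]
  exact Subalgebra.sum_mem _ fun σ _ =>
    Subalgebra.zsmul_mem _ (Subalgebra.prod_mem _ fun i _ => hM _ _) _

theorem polyFun_curve {f : W → 𝕜} (hf : f ∈ polyFun 𝕜 W) (c₀ c₁ c₂ : W) :
    ∃ p : Polynomial 𝕜, ∀ t : ℝ, f (c₀ + t • c₁ + t ^ 2 • c₂) = p.eval (t : 𝕜) := by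
  induction hf using Algebra.adjoin_induction with
  | mem f hf =>
    obtain ⟨L, rfl⟩ := hf
    refine ⟨.C (L c₀) + .X * .C (L c₁) + .X ^ 2 * .C (L c₂), fun t => ?_⟩
    simp only [map_add, map_smul, RCLike.real_smul_eq_coe_mul, Polynomial.eval_add,
      Polynomial.eval_mul, Polynomial.eval_C, Polynomial.eval_X, Polynomial.eval_pow,
      RCLike.ofReal_pow]
  | algebraMap r => exact ⟨.C r, fun t => by simp⟩
  | add f g _ _ hf hg =>
    obtain ⟨p, hp⟩ := hf
    obtain ⟨q, hq⟩ := hg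
    exact ⟨p + q, fun t => by simp [hp, hq]⟩
  | mul f g _ _ hf hg =>
    obtain ⟨p, hp⟩ := hf
    obtain ⟨q, hq⟩ := hg
    exact ⟨p * q, fun t => by simp [hp, hq]⟩

/-- This connects the coordinate-free class of functions with the real polynomials that define
algebraic sets. -/
theorem polyFun_coord {N : ℕ} (φ : W ≃ₗ[ℝ] (Fin N → ℝ)) {f : W → 𝕜} (hf : f ∈ polyFun 𝕜 W) :
    ∃ p q : MvPolynomial (Fin N) ℝ, ∀ v,
      RCLike.re (f v) = MvPolynomial.eval (φ v) p ∧
      RCLike.im (f v) = MvPolynomial.eval (φ v) q := by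
  have key : ∀ g : W →ₗ[ℝ] ℝ, ∃ p : MvPolynomial (Fin N) ℝ, ∀ v,
      g v = MvPolynomial.eval (φ v) p := by
    intro g
    refine ⟨∑ i, MvPolynomial.C (g (φ.symm (Pi.single i 1))) * MvPolynomial.X i, fun v => ?_⟩
    have h1 := LinearMap.pi_apply_eq_sum_univ (g ∘ₗ φ.symm.toLinearMap) (φ v)
    simp only [LinearMap.comp_apply, LinearEquiv.coe_coe, LinearEquiv.symm_apply_apply] at h1
    rw [h1]
    simp only [map_sum, map_mul, MvPolynomial.eval_C, MvPolynomial.eval_X, smul_eq_mul]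
    refine Finset.sum_congr rfl fun i _ => ?_
    rw [mul_comm]
    congr 3
    ext j
    simp [Pi.single_apply, eq_comm]
  induction hf using Algebra.adjoin_induction with
  | mem f hf =>
    obtain ⟨L, rfl⟩ := hf
    obtain ⟨p, hp⟩ := key (RCLike.reLm ∘ₗ L)
    obtain ⟨q, hq⟩ := key (RCLike.imLm ∘ₗ L)
    exact ⟨p, q, fun v => ⟨hp v, hq v⟩⟩
  | algebraMap r => exact ⟨.C (RCLike.re r), .C (RCLike.im r), fun v => by simp⟩
  | add f g _ _ hf hg =>
    obtain ⟨p, q, h⟩ := hf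
    obtain ⟨p', q', h'⟩ := hg
    exact ⟨p + p', q + q', fun v => by simp [(h v).1, (h v).2, (h' v).1, (h' v).2]⟩
  | mul f g _ _ hf hg =>
    obtain ⟨p, q, h⟩ := hf
    obtain ⟨p', q', h'⟩ := hg
    exact ⟨p * p' - q * q', p * q' + q * p',
      fun v => by simp [(h v).1, (h v).2, (h' v).1, (h' v).2]⟩

variable [TopologicalSpace W] [IsTopologicalAddGroup W] [ContinuousSMul ℝ W]

/-- Along a curve ending at `v₁` the function is a polynomial in `t` that is nonzero at `t = 1`. It
has finitely many zeros, so points of the curve with small `t > 0` lie off the zero set and converge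
to the starting point. -/
theorem subset_closure_of_curves {f : W → 𝕜} (hf : f ∈ polyFun 𝕜 W) {V : Set W} {v₁ : W}
    (h₁ : f v₁ ≠ 0)
    (hV : V ⊆ closure {v | ∃ c₁ c₂ : W, v + c₁ + c₂ = v₁ ∧
      ∀ t ∈ Set.Icc (0 : ℝ) 1, v + t • c₁ + t ^ 2 • c₂ ∈ V}) :
    V ⊆ closure ({v | f v ≠ 0} ∩ V) := by
  refine hV.trans (closure_minimal ?_ isClosed_closure)
  rintro v ⟨c₁, c₂, hv₁, hc⟩
  obtain ⟨p, hp⟩ := polyFun_curve hf v c₁ c₂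
  have hp0 : p ≠ 0 := by
    rintro rfl
    have := hp 1
    simp only [one_smul, one_pow, Polynomial.eval_zero] at this
    exact h₁ (hv₁ ▸ this)
  have hfin : {t : ℝ | p.eval (t : 𝕜) = 0}.Finite := by
    refine Set.Finite.preimage (f := fun t : ℝ => (t : 𝕜))
      (RCLike.ofReal_injective.injOn) (s := {z | p.eval z = 0}) ?_
    exact (p.rootSet_finite 𝕜).subset fun z hz => by
      simpa [Polynomial.mem_rootSet, hp0] using hz
  have hcont : Tendsto (fun t : ℝ => v + t • c₁ + t ^ 2 • c₂) (𝓝[>] 0) (𝓝 v) := by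
    have : Continuous fun t : ℝ => v + t • c₁ + t ^ 2 • c₂ := by fun_prop
    have h := (this.tendsto 0).mono_left (nhdsWithin_le_nhds (s := Set.Ioi 0))
    simpa using h
  refine mem_closure_of_tendsto hcont ?_
  have h1 : ∀ᶠ t : ℝ in 𝓝[>] 0, t ∈ Set.Ioo (0 : ℝ) 1 := Ioo_mem_nhdsGT one_pos
  have h2 : ∀ᶠ t : ℝ in 𝓝[>] 0, p.eval (t : 𝕜) ≠ 0 := by
    -- The starting point itself may be a zero, so `0` is removed from the finite set of roots
    -- before taking the complement.
    have : ({t : ℝ | p.eval (t : 𝕜) = 0} \ {0})ᶜ ∈ 𝓝 (0 : ℝ) :=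
      (hfin.subset Set.sdiff_subset).isClosed.isOpen_compl.mem_nhds (by simp)
    filter_upwards [mem_nhdsWithin_of_mem_nhds this, self_mem_nhdsWithin] with t ht h0 hz
    exact ht ⟨hz, ne_of_gt h0⟩
  filter_upwards [h1, h2] with t ht1 ht2
  refine ⟨?_, hc t ⟨ht1.1.le, ht1.2.le⟩⟩
  rw [Set.mem_ofPred_eq, hp]
  exact ht2

variable [T2Space W] [FiniteDimensional ℝ W]

theorem continuous_of_mem_polyFun {f : W → 𝕜} (hf : f ∈ polyFun 𝕜 W) : Continuous f := by
  induction hf using Algebra.adjoin_induction with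
  | mem f hf =>
    obtain ⟨L, rfl⟩ := hf
    exact L.continuous_of_finiteDimensional
  | algebraMap r => exact continuous_const
  | add f g _ _ hf hg => exact hf.add hg
  | mul f g _ _ hf hg => exact hf.mul hg

theorem isRelGeneric_of_polyFun {f : W → 𝕜} (hf : f ∈ polyFun 𝕜 W) {S V : Set W}
    (hS : ∀ v ∈ V, f v ≠ 0 → v ∈ S) (hV : V ⊆ closure ({v | f v ≠ 0} ∩ V)) :
    IsRelGeneric S V := by
  let φ : W ≃ₗ[ℝ] (Fin (Module.finrank ℝ W) → ℝ) := (Module.finBasis ℝ W).equivFun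
  -- The zero set of the `𝕜`-valued `f` is cut out by two real polynomials, its real and imaginary
  -- parts.
  obtain ⟨p, q, h⟩ := polyFun_coord φ hf
  have h0 : ∀ v, f v = 0 ↔ ∀ i, MvPolynomial.eval (φ v) (![p, q] i) = 0 := by
    intro v
    rw [RCLike.ext_iff (K := 𝕜), (h v).1, (h v).2]
    simp [Fin.forall_fin_two]
  refine ⟨_, φ, {x | ∀ i, MvPolynomial.eval x (![p, q] i) = 0}, ⟨2, ![p, q], rfl⟩, ?_, ?_⟩
  · rintro _ ⟨hx, v, hv, rfl⟩
    refine ⟨(h0 v).1 ?_, v, hv, rfl⟩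
    by_contra hne
    exact hx ⟨v, hS v hv hne, rfl⟩
  · have h1 : φ '' V ⊆ φ '' closure ({v | f v ≠ 0} ∩ V) := Set.image_mono hV
    have hφ : Continuous φ := φ.toLinearMap.continuous_of_finiteDimensional
    refine (h1.trans (image_closure_subset_closure_image hφ)).trans (closure_mono ?_)
    rintro _ ⟨v, ⟨hv, hvV⟩, rfl⟩
    exact ⟨fun hc => hv ((h0 v).2 hc), v, hvV, rfl⟩

/-- Complements of algebraic sets are open. This topological consequence is all that the negative
results need. -/
theorem IsRelGeneric.exists_isOpen {S V : Set W} (h : IsRelGeneric S V) :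
    ∃ O : Set W, IsOpen O ∧ O ∩ V ⊆ S ∧ V ⊆ closure (O ∩ V) := by
  obtain ⟨N, φ, A, ⟨k, p, rfl⟩, hS, hV⟩ := h
  have hφ : Continuous φ := φ.toLinearMap.continuous_of_finiteDimensional
  have hφ' : Continuous φ.symm := φ.symm.toLinearMap.continuous_of_finiteDimensional
  refine ⟨φ ⁻¹' {x | ∀ i, MvPolynomial.eval x (p i) = 0}ᶜ, ?_, ?_, ?_⟩
  · refine IsOpen.preimage hφ (IsClosed.isOpen_compl (self := ?_))
    rw [Set.ofPred_forall]
    exact isClosed_iInter fun i => isClosed_eq (MvPolynomial.continuous_eval _) continuous_const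
  · rintro v ⟨hv, hvV⟩
    by_contra hvS
    have := hS ⟨fun ⟨w, hw, hwv⟩ => hvS (φ.injective hwv ▸ hw), v, hvV, rfl⟩
    exact hv this.1
  · intro v hv
    have h1 := image_closure_subset_closure_image hφ' ⟨φ v, hV ⟨v, hv, rfl⟩, rfl⟩
    rw [LinearEquiv.symm_apply_apply] at h1
    refine closure_mono ?_ h1
    rintro _ ⟨_, ⟨hx, w, hw, rfl⟩, rfl⟩
    rw [LinearEquiv.symm_apply_apply]
    exact ⟨hx, hw⟩

/-- Two relatively open dense subsets of a nonempty set meet. -/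
theorem IsRelGeneric.not_compl {S V : Set W} (h : IsRelGeneric S V) (hne : V.Nonempty) :
    ¬ IsRelGeneric Sᶜ V := by
  intro h'
  obtain ⟨O, hO, hOS, hOV⟩ := h.exists_isOpen
  obtain ⟨O', hO', hOS', hOV'⟩ := h'.exists_isOpen
  obtain ⟨v, hv⟩ := hne
  obtain ⟨w, hw⟩ : (O ∩ V).Nonempty := by
    rw [← closure_nonempty_iff]; exact ⟨v, hOV hv⟩
  obtain ⟨z, hz, hz'⟩ := mem_closure_iff.1 (hOV' hw.2) O hO hw.1
  exact hOS' hz' (hOS ⟨hz, hz'.2⟩)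

theorem not_isRelGeneric_of_hasNonemptyRelInterior {S V : Set W}
    (h : HasNonemptyRelInterior Sᶜ V) : ¬ IsRelGeneric S V := by
  intro h'
  obtain ⟨O, hO, hOS, hOV⟩ := h'.exists_isOpen
  obtain ⟨v, hv⟩ := h
  obtain ⟨U, hU, hUo, hvU⟩ := mem_interior.1 hv
  obtain ⟨U', hU', rfl⟩ := isOpen_induced_iff.1 hUo
  obtain ⟨z, hz, hz'⟩ := mem_closure_iff.1 (hOV v.2) U' hU' hvU
  exact hU (show (⟨z, hz'.2⟩ : V) ∈ _ from hz) (hOS hz')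

end PolyFun

/-! ### Polynomial families of linear maps -/

section PolyMap

variable {𝕜 : Type*} [RCLike 𝕜] {W : Type*} [AddCommGroup W] [Module ℝ W]
  {X Z Z' : Type*} [AddCommGroup X] [Module 𝕜 X] [AddCommGroup Z] [Module 𝕜 Z]
  [AddCommGroup Z'] [Module 𝕜 Z']

/-- Polynomial maps into a `𝕜`-vector space. -/
def IsPolyMap (f : W → Z) : Prop := ∀ g : Z →ₗ[𝕜] 𝕜, (fun v => g (f v)) ∈ polyFun 𝕜 W

theorem isPolyMap_pi {ι : Type*} [Fintype ι] {Y : ι → Type*}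
    [∀ i, AddCommGroup (Y i)] [∀ i, Module 𝕜 (Y i)] {f : W → ∀ i, Y i}
    (h : ∀ i, IsPolyMap (𝕜 := 𝕜) fun v => f v i) : IsPolyMap (𝕜 := 𝕜) f := by
  classical
  intro g
  have : (fun v => g (f v)) = ∑ i, fun v => (g ∘ₗ LinearMap.single 𝕜 Y i) (f v i) := by
    ext v
    conv_lhs => rw [← Finset.univ_sum_single (f v)]
    simp
  rw [this]
  exact Subalgebra.sum_mem _ fun i _ => h i _

theorem isPolyMap_prod {f : W → Z × Z'} (h : IsPolyMap (𝕜 := 𝕜) fun v => (f v).1)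
    (h' : IsPolyMap (𝕜 := 𝕜) fun v => (f v).2) : IsPolyMap (𝕜 := 𝕜) f := by
  intro g
  have : (fun v => g (f v)) = (fun v => (g ∘ₗ LinearMap.inl 𝕜 Z Z') (f v).1) +
      fun v => (g ∘ₗ LinearMap.inr 𝕜 Z Z') (f v).2 := by
    ext v
    simp [← map_add]
  rw [this]
  exact add_mem (h _) (h' _)

theorem isPolyMap_const (z : Z) : IsPolyMap (𝕜 := 𝕜) fun _ : W => z := fun g =>
  Subalgebra.algebraMap_mem (polyFun 𝕜 W) (g z)

theorem IsPolyMap.sub {f f' : W → Z} (h : IsPolyMap (𝕜 := 𝕜) f) (h' : IsPolyMap (𝕜 := 𝕜) f') :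
    IsPolyMap (𝕜 := 𝕜) fun v => f v - f' v := fun g => by
  simp only [map_sub]
  exact sub_mem (h g) (h' g)

theorem isPolyMap_of_mem {f : W → 𝕜} (h : f ∈ polyFun 𝕜 W) : IsPolyMap (𝕜 := 𝕜) f := fun g => by
  have : (fun v => g (f v)) = g 1 • f := by
    ext v
    have := g.map_smul (f v) 1
    simp only [smul_eq_mul, mul_one] at this
    simp [this, mul_comm]
  rw [this]
  exact Subalgebra.smul_mem _ h _

theorem isPolyMap_mulVec {p q : ℕ} {M : W → Matrix (Fin p) (Fin q) 𝕜}
    (hM : ∀ i j, (fun v => M v i j) ∈ polyFun 𝕜 W) (x : Fin q → 𝕜) :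
    IsPolyMap (𝕜 := 𝕜) fun v => M v *ᵥ x := by
  refine isPolyMap_pi fun i => isPolyMap_of_mem ?_
  have : (fun v => (M v *ᵥ x) i) = ∑ j, x j • fun v => M v i j := by
    ext v
    simp [Matrix.mulVec, dotProduct, mul_comm]
  rw [this]
  exact Subalgebra.sum_mem _ fun j _ => Subalgebra.smul_mem _ (hM i j) _

/-- Surjectivity of a polynomial family of linear maps is witnessed by a polynomial. -/
theorem exists_polyFun_surjective [Module.Finite 𝕜 Z] (Φ : W → X →ₗ[𝕜] Z)
    (hΦ : ∀ x, IsPolyMap (𝕜 := 𝕜) fun v => Φ v x) {v₁ : W} (h₁ : Function.Surjective (Φ v₁)) :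
    ∃ f ∈ polyFun 𝕜 W, f v₁ ≠ 0 ∧ ∀ v, f v ≠ 0 → Function.Surjective (Φ v) := by
  -- The right inverse `C` at `v₁` is kept fixed. Then `Φ v ∘ C` is an endomorphism of the
  -- finite-dimensional target, whatever the dimension of the source; its determinant is polynomial
  -- in `v` and equals `1` at `v₁`.
  obtain ⟨C, hC⟩ := (Φ v₁).exists_rightInverse_of_surjective (LinearMap.range_eq_top.2 h₁)
  let b := Module.finBasis 𝕜 Z
  refine ⟨fun v => (LinearMap.toMatrix b b (Φ v ∘ₗ C)).det, polyFun_det fun i j => ?_, ?_, ?_⟩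
  · simp only [LinearMap.toMatrix_apply, LinearMap.comp_apply]
    exact hΦ (C (b j)) (b.coord i)
  · simp [hC]
  · intro v hv
    simp only [LinearMap.det_toMatrix] at hv
    have h1 : Function.Surjective (Φ v ∘ₗ C) :=
      (LinearMap.equivOfDetNeZero _ hv).surjective
    exact Function.Surjective.of_comp h1

end PolyMap

end PortHamiltonian

namespace PortHamiltonian

variable {𝕜 : Type*} [RCLike 𝕜] {ℓ n m : ℕ}

/-! ### A family of reference systems -/

/-- The skew-symmetric tridiagonal matrix with entries `±1`. -/
def skewTridiag (𝕜 : Type*) [RCLike 𝕜] (ℓ : ℕ) : Matrix (Fin ℓ) (Fin ℓ) 𝕜 :=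
  fun i j => if (j : ℕ) = i + 1 then 1 else if (i : ℕ) = j + 1 then -1 else 0

/-- The rectangular identity matrix. -/
def rectOne (𝕜 : Type*) [RCLike 𝕜] (ℓ n : ℕ) : Matrix (Fin ℓ) (Fin n) 𝕜 :=
  fun i j => if (i : ℕ) = j then 1 else 0

theorem skewTridiag_conjTranspose : (skewTridiag 𝕜 ℓ)ᴴ = -skewTridiag 𝕜 ℓ := by
  ext i j
  simp only [skewTridiag, conjTranspose_apply, Matrix.neg_apply]
  split_ifs <;> first | omega | simp

theorem skewTridiag_transpose : (skewTridiag 𝕜 ℓ)ᵀ = -skewTridiag 𝕜 ℓ := by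
  ext i j
  simp only [skewTridiag, transpose_apply, Matrix.neg_apply]
  split_ifs <;> first | omega | simp

/-- Extending the vector by zero beyond `ℓ` removes the upper boundary case. The lower one needs the
guard because `0 - 1 = 0` in `ℕ`. -/
theorem sum_skewTridiag_mul (c : ℕ → 𝕜) (hc : ∀ i, ℓ ≤ i → c i = 0) (i : Fin ℓ) :
    ∑ j : Fin ℓ, skewTridiag 𝕜 ℓ i j * c j =
      c (i + 1) - if 0 < (i : ℕ) then c (i - 1) else 0 := by
  have h1 : ∀ j : ℕ, (if j = i + 1 then (1 : 𝕜) else if (i : ℕ) = j + 1 then -1 else 0) * c j =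
      (if j = i + 1 then c j else 0) - if (i : ℕ) = j + 1 then c j else 0 := by
    intro j
    split_ifs with h h' <;> simp
    omega
  have h2 : ∑ j : Fin ℓ, skewTridiag 𝕜 ℓ i j * c j = ∑ j ∈ Finset.range ℓ,
      ((if j = (i : ℕ) + 1 then c j else 0) - if (i : ℕ) = j + 1 then c j else 0) := by
    rw [← Fin.sum_univ_eq_sum_range (fun j =>
      ((if j = (i : ℕ) + 1 then c j else 0) - if (i : ℕ) = j + 1 then c j else 0))]
    exact Finset.sum_congr rfl fun j _ => h1 j
  rw [h2, Finset.sum_sub_distrib]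
  congr 1
  · rw [Finset.sum_ite_eq']
    split_ifs with h
    · rfl
    · exact (hc _ (by simpa using h)).symm
  · split_ifs with h
    · rw [Finset.sum_eq_single ((i : ℕ) - 1)]
      · rw [if_pos (by omega)]
      · intro j _ hj
        rw [if_neg (by omega)]
      · intro hj
        exact absurd (Finset.mem_range.2 (by omega)) hj
    · exact Finset.sum_eq_zero fun j _ => if_neg (by omega)

theorem sum_reference_mul (ρ : 𝕜) (c : ℕ → 𝕜) (hc : ∀ i, ℓ ≤ i → c i = 0) (i : Fin ℓ) :
    ∑ j : Fin ℓ, (skewTridiag 𝕜 ℓ - ρ • (1 : Matrix (Fin ℓ) (Fin ℓ) 𝕜)) i j * c j =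
      c (i + 1) - (if 0 < (i : ℕ) then c (i - 1) else 0) - ρ * c i := by
  simp only [Matrix.sub_apply, sub_mul, Finset.sum_sub_distrib, sum_skewTridiag_mul c hc]
  congr 1
  rw [Finset.sum_eq_single i]
  · simp
  · intro j _ hj
    simp [Matrix.one_apply_ne hj.symm]
  · simp

theorem sum_mul_reference (ρ : 𝕜) (c : ℕ → 𝕜) (hc : ∀ i, ℓ ≤ i → c i = 0) (i : Fin ℓ) :
    ∑ j : Fin ℓ, (skewTridiag 𝕜 ℓ - ρ • (1 : Matrix (Fin ℓ) (Fin ℓ) 𝕜)) j i * c j =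
      (if 0 < (i : ℕ) then c (i - 1) else 0) - c (i + 1) - ρ * c i := by
  -- Transposition negates the skew part, so the transpose is minus the same matrix with `-ρ` for
  -- `ρ`.
  have h : ∀ j, (skewTridiag 𝕜 ℓ - ρ • (1 : Matrix (Fin ℓ) (Fin ℓ) 𝕜)) j i =
      -(skewTridiag 𝕜 ℓ - (-ρ) • (1 : Matrix (Fin ℓ) (Fin ℓ) 𝕜)) i j := by
    intro j
    have h1 : skewTridiag 𝕜 ℓ j i = -skewTridiag 𝕜 ℓ i j :=
      congrFun (congrFun skewTridiag_transpose i) j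
    by_cases hij : j = i
    · subst hij
      simp only [Matrix.sub_apply, Matrix.smul_apply, Matrix.one_apply_eq, smul_eq_mul]
      linear_combination h1
    · simp only [Matrix.sub_apply, Matrix.smul_apply, Matrix.one_apply_ne hij,
        Matrix.one_apply_ne (Ne.symm hij), smul_eq_mul]
      linear_combination h1
  simp only [h, neg_mul, Finset.sum_neg_distrib, sum_reference_mul (-ρ) c hc]
  ring

/-- A doubly indexed sequence that satisfies the tridiagonal recursion on a sufficiently long time
interval and whose first component vanishes there is zero. -/
theorem eq_zero_of_recursion {w : ℕ → ℕ → 𝕜} {a b r : ℕ} (ρ : 𝕜) (hab : a + r ≤ b)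
    (h0 : ∀ k, a ≤ k → k ≤ b → w k 0 = 0) (hr : ∀ k, a ≤ k → k ≤ b → ∀ i, r ≤ i → w k i = 0)
    (hstep : ∀ k, a ≤ k → k < b → ∀ i, i < r →
      w (k + 1) i = (if 0 < i then w k (i - 1) else 0) - w k (i + 1) - ρ * w k i) :
    ∀ k, a ≤ k → k ≤ b → ∀ i, w k i = 0 := by
  -- Solving the recursion for `w k (i + 1)` spreads zeros from component `0` to the higher ones,
  -- each component costing one time step.
  have h1 : ∀ i k, a ≤ k → k + i ≤ b → w k i = 0 := by
    intro i
    induction i using Nat.strong_induction_on with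
    | _ i ih =>
      intro k hk hkb
      rcases Nat.eq_zero_or_pos i with rfl | hi
      · exact h0 k hk hkb
      · obtain ⟨j, rfl⟩ : ∃ j, i = j + 1 := ⟨i - 1, by omega⟩
        by_cases hjr : j < r
        · have h2 := hstep k hk (by omega) j hjr
          rw [ih j (by omega) (k + 1) (by omega) (by omega), ih j (by omega) k hk (by omega)] at h2
          have h3 : (if 0 < j then w k (j - 1) else 0) = 0 := by
            split_ifs with hj
            · exact ih (j - 1) (by omega) k hk (by omega)
            · rfl
          rw [h3] at h2
          simpa using h2.symm
        · exact hr k hk (by omega) _ (by omega)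
  -- As the interval has length at least `r`, time `a` is entirely zero, and the recursion
  -- propagates this forward.
  intro k hk
  induction k, hk using Nat.le_induction with
  | base =>
    intro _ i
    by_cases hi : i < r
    · exact h1 i a le_rfl (by omega)
    · exact hr a le_rfl (by omega) i (not_lt.1 hi)
  | succ k hk ih =>
    intro hkb i
    have ih := ih (by omega)
    by_cases hi : i < r
    · rw [hstep k hk (by omega) i hi]
      simp [ih]
    · exact hr (k + 1) (by omega) hkb i (not_lt.1 hi)

/-! ### The controllable reference systems -/

/-- The input matrix of the controllable reference systems: the first column is the first unit
vector, the next ones are the unit vectors outside the range of `rectOne`. -/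
def controlMatrix (𝕜 : Type*) [RCLike 𝕜] (ℓ n m : ℕ) : Matrix (Fin ℓ) (Fin m) 𝕜 :=
  fun i c => if (c : ℕ) = 0 then (if (i : ℕ) = 0 then 1 else 0) else
    if (i : ℕ) + 1 = min n ℓ + c then 1 else 0

/-- The coefficients of `(s E - A) x(s) - B u(s)` up to degree `N + 1`, for `x` and `u` of degree
at most `N` and `N + 1`, together with one of the coefficients of `x`. -/
def stateMap (E A : Matrix (Fin ℓ) (Fin n) 𝕜) (B : Matrix (Fin ℓ) (Fin m) 𝕜) (N k₀ : ℕ) :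
    ((ℕ → Fin n → 𝕜) × (ℕ → Fin m → 𝕜)) →ₗ[𝕜] ((Fin (N + 2) → Fin ℓ → 𝕜) × (Fin n → 𝕜)) where
  toFun z := (fun k => (if (k : ℕ) = 0 then 0 else E *ᵥ z.1 (k - 1)) -
    (if (k : ℕ) ≤ N then A *ᵥ z.1 k else 0) - B *ᵥ z.2 k, z.1 k₀)
  map_add' z z' := by
    refine Prod.ext (funext fun k => ?_) (by simp)
    simp only [Prod.fst_add, Prod.snd_add, Pi.add_apply, mulVec_add]
    split_ifs <;> abel
  map_smul' c z := by
    refine Prod.ext (funext fun k => ?_) (by simp)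
    simp only [Prod.smul_fst, Prod.smul_snd, Pi.smul_apply, mulVec_smul, RingHom.id_apply, smul_sub]
    split_ifs <;> simp

theorem hasStateChains_of_surjective {E A : Matrix (Fin ℓ) (Fin n) 𝕜}
    {B : Matrix (Fin ℓ) (Fin m) 𝕜} {N k₀ : ℕ} (hk₀ : k₀ ≤ N)
    (h : Function.Surjective (stateMap E A B N k₀)) : HasStateChains E A B := by
  intro ξ
  obtain ⟨⟨x, u⟩, hz⟩ := h (0, ξ)
  have h1 : ∀ k : Fin (N + 2), (if (k : ℕ) = 0 then 0 else E *ᵥ x (k - 1)) -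
      (if (k : ℕ) ≤ N then A *ᵥ x k else 0) - B *ᵥ u k = 0 :=
    fun k => congrFun (congrArg Prod.fst hz) k
  have h2 : x k₀ = ξ := congrArg Prod.snd hz
  refine ⟨fun k => if k ≤ N then x k else 0, fun k => if k ≤ N + 1 then u k else 0, N + 2, k₀,
    fun k hk => ⟨if_neg (by omega), if_neg (by omega)⟩, ?_, fun k => ?_, ?_⟩
  · have := h1 0
    simp only [Fin.val_zero, if_true, Nat.zero_le, zero_sub] at this ⊢
    rw [← neg_eq_zero, neg_add]
    simpa [sub_eq_add_neg] using this
  · beta_reduce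
    by_cases hk : k ≤ N
    · have := h1 ⟨k + 1, by omega⟩
      simp only [Nat.add_eq_zero_iff, one_ne_zero, and_false, if_false, Nat.add_sub_cancel] at this
      rw [if_pos hk, if_pos (by omega : k + 1 ≤ N + 1)]
      rw [sub_sub, sub_eq_zero] at this
      rw [this]
      split_ifs <;> simp
    · rw [if_neg hk, if_neg (by omega), if_neg (by omega)]
      simp
  · simp [hk₀, h2]

theorem stateMap_single (E A : Matrix (Fin ℓ) (Fin n) 𝕜) (B : Matrix (Fin ℓ) (Fin m) 𝕜)
    (N k₀ k : ℕ) (hk : k ≤ N) (ξ : Fin n → 𝕜) :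
    stateMap E A B N k₀ (Pi.single k ξ, 0) =
      (Pi.single ⟨k + 1, by omega⟩ (E *ᵥ ξ) - Pi.single ⟨k, by omega⟩ (A *ᵥ ξ),
        if k = k₀ then ξ else 0) := by
  refine Prod.ext (funext fun j => ?_) ?_
  · simp only [stateMap, LinearMap.coe_mk, AddHom.coe_mk, Pi.zero_apply, mulVec_zero, sub_zero,
      Pi.sub_apply, Pi.single_apply, Fin.ext_iff]
    congr 1
    · by_cases h1 : (j : ℕ) = 0
      · rw [if_pos h1, if_neg (by omega)]
      · by_cases h2 : (j : ℕ) = k + 1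
        · rw [if_neg h1, if_pos (by omega), if_pos h2]
        · rw [if_neg h1, if_neg (by omega), if_neg h2, mulVec_zero]
    · by_cases h2 : (j : ℕ) = k
      · rw [if_pos (by omega), if_pos h2, if_pos h2]
      · rw [if_neg h2, if_neg h2, mulVec_zero, ite_self]
  · simp [stateMap, Pi.single_apply, eq_comm]

theorem stateMap_single_input (E A : Matrix (Fin ℓ) (Fin n) 𝕜) (B : Matrix (Fin ℓ) (Fin m) 𝕜)
    (N k₀ k : ℕ) (hk : k < N + 2) (η : Fin m → 𝕜) :
    stateMap E A B N k₀ (0, Pi.single k η) = (-Pi.single ⟨k, hk⟩ (B *ᵥ η), 0) := by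
  refine Prod.ext (funext fun j => ?_) ?_
  · simp only [stateMap, LinearMap.coe_mk, AddHom.coe_mk, Pi.zero_apply, mulVec_zero, ite_self,
      Pi.neg_apply, Pi.single_apply, Fin.ext_iff, zero_sub]
    by_cases h2 : (j : ℕ) = k
    · rw [if_pos h2, if_pos h2, neg_zero, zero_sub]
    · rw [if_neg h2, if_neg h2, mulVec_zero, sub_zero, neg_zero]
  · simp [stateMap]

theorem rectOne_mulVec_single (i : ℕ) (hi : i < ℓ) (hn : i < n) :
    rectOne 𝕜 ℓ n *ᵥ Pi.single ⟨i, hn⟩ 1 = Pi.single ⟨i, hi⟩ 1 := by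
  ext j
  simp [rectOne, Pi.single_apply, Fin.ext_iff]

theorem apply_mulVec_single {p : ℕ} (φ : (Fin p → 𝕜) →ₗ[𝕜] 𝕜) (M : Matrix (Fin p) (Fin p) 𝕜)
    (i : Fin p) : φ (M *ᵥ Pi.single i 1) = ∑ j, M j i * φ (Pi.single j 1) := by
  conv_lhs => rw [LinearMap.pi_apply_eq_sum_univ φ]
  refine Finset.sum_congr rfl fun j _ => ?_
  simp only [mulVec_single_one, col_apply, smul_eq_mul]
  congr 2
  ext k
  simp [Pi.single_apply, eq_comm]

/-- By duality it suffices that a functional vanishing on the range is zero. Its components satisfy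
the transposed tridiagonal recursion; the first input column kills component `0`, the others kill
the components from `min n ℓ` on, which is possible because `ℓ < n + m`. Only the equation at time
`ℓ`, where a coefficient of `x` is prescribed, disturbs the recursion. The degree bound `2 * ℓ`
leaves an undisturbed interval of length `ℓ` on each side of it. -/
theorem stateMap_reference_surjective (ρ : 𝕜) (hℓ : 0 < ℓ) (hm : 0 < m) (hlt : ℓ < n + m) :
    Function.Surjective (stateMap (rectOne 𝕜 ℓ n)
      ((skewTridiag 𝕜 ℓ - ρ • (1 : Matrix (Fin ℓ) (Fin ℓ) 𝕜)) * rectOne 𝕜 ℓ n)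
      (controlMatrix 𝕜 ℓ n m) (2 * ℓ) ℓ) := by
  rw [← LinearMap.range_eq_top]
  by_contra hne
  obtain ⟨g, hg0, hg⟩ := Submodule.exists_le_ker_of_lt_top _ (lt_top_iff_ne_top.2 hne)
  have hgz : ∀ z, g (stateMap (rectOne 𝕜 ℓ n)
      ((skewTridiag 𝕜 ℓ - ρ • (1 : Matrix (Fin ℓ) (Fin ℓ) 𝕜)) * rectOne 𝕜 ℓ n)
      (controlMatrix 𝕜 ℓ n m) (2 * ℓ) ℓ z) = 0 := fun z => hg ⟨z, rfl⟩
  let G : ℕ → (Fin ℓ → 𝕜) →ₗ[𝕜] 𝕜 := fun k => if h : k < 2 * ℓ + 2 then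
    g ∘ₗ LinearMap.inl 𝕜 _ _ ∘ₗ LinearMap.single 𝕜 (fun _ => Fin ℓ → 𝕜) ⟨k, h⟩ else 0
  have hG : ∀ k (h : k < 2 * ℓ + 2) ξ, g (Pi.single ⟨k, h⟩ ξ, 0) = G k ξ := by
    intro k h ξ
    simp [G, h]
  have hstate : ∀ k, k ≤ 2 * ℓ → ∀ ξ, G (k + 1) (rectOne 𝕜 ℓ n *ᵥ ξ) -
      G k ((skewTridiag 𝕜 ℓ - ρ • (1 : Matrix (Fin ℓ) (Fin ℓ) 𝕜)) *ᵥ (rectOne 𝕜 ℓ n *ᵥ ξ)) +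
      g (0, if k = ℓ then ξ else 0) = 0 := by
    intro k hk ξ
    have := hgz (Pi.single k ξ, 0)
    rw [stateMap_single _ _ _ _ _ _ hk] at this
    rw [← hG (k + 1) (by omega), ← hG k (by omega), ← map_sub, ← map_add, mulVec_mulVec]
    simpa using this
  have hinput : ∀ k, k < 2 * ℓ + 2 → ∀ η, G k (controlMatrix 𝕜 ℓ n m *ᵥ η) = 0 := by
    intro k hk η
    have := hgz (0, Pi.single k η)
    rw [stateMap_single_input _ _ _ _ _ _ hk] at this
    rw [← hG k hk, ← neg_eq_zero, ← map_neg]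
    simpa using this
  let w : ℕ → ℕ → 𝕜 := fun k i => if h : i < ℓ then G k (Pi.single ⟨i, h⟩ 1) else 0
  have hw : ∀ k (i : Fin ℓ), G k (Pi.single i 1) = w k i := fun k i => by simp [w]
  have hwℓ : ∀ k i, ℓ ≤ i → w k i = 0 := fun k i hi => by simp [w, hi]
  have hw0 : ∀ k, k < 2 * ℓ + 2 → w k 0 = 0 := by
    intro k hk
    have h1 := hinput k hk (Pi.single ⟨0, hm⟩ 1)
    have h2 : controlMatrix 𝕜 ℓ n m *ᵥ Pi.single ⟨0, hm⟩ 1 = Pi.single ⟨0, hℓ⟩ 1 := by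
      ext j
      simp [controlMatrix, Pi.single_apply, Fin.ext_iff]
    rw [h2, hw] at h1
    exact h1
  have hwr : ∀ k, k < 2 * ℓ + 2 → ∀ i, min n ℓ ≤ i → w k i = 0 := by
    intro k hk i hi
    by_cases hiℓ : i < ℓ
    · have hc : i + 1 - min n ℓ < m := by omega
      have h1 := hinput k hk (Pi.single ⟨i + 1 - min n ℓ, hc⟩ 1)
      have h2 : controlMatrix 𝕜 ℓ n m *ᵥ Pi.single ⟨i + 1 - min n ℓ, hc⟩ 1 =
          Pi.single ⟨i, hiℓ⟩ 1 := by
        ext j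
        have h3 : ¬ (i + 1 - min n ℓ = 0) := by omega
        have h4 : (j : ℕ) + 1 = min n ℓ + (i + 1 - min n ℓ) ↔ (j : ℕ) = i := by omega
        simp only [mulVec_single_one, col_apply, controlMatrix, h3, if_false, h4,
          Pi.single_apply, Fin.ext_iff]
      rw [h2, hw] at h1
      exact h1
    · exact hwℓ k i (not_lt.1 hiℓ)
  have hstep : ∀ k, k ≤ 2 * ℓ → k ≠ ℓ → ∀ i, i < min n ℓ →
      w (k + 1) i = (if 0 < i then w k (i - 1) else 0) - w k (i + 1) - ρ * w k i := by
    intro k hk hkℓ i hi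
    have hiℓ : i < ℓ := by omega
    have hin : i < n := by omega
    have h1 := hstate k hk (Pi.single ⟨i, hin⟩ 1)
    rw [rectOne_mulVec_single i hiℓ hin, if_neg hkℓ, apply_mulVec_single] at h1
    simp only [hw] at h1
    rw [sum_mul_reference ρ (w k) (hwℓ k) ⟨i, hiℓ⟩] at h1
    have h2 : g (0, 0) = 0 := g.map_zero
    rw [h2, add_zero, sub_eq_zero] at h1
    exact h1
  have hz1 := eq_zero_of_recursion (w := w) (a := 0) (b := ℓ) (r := min n ℓ) ρ (by omega)
    (fun k _ hk => hw0 k (by omega)) (fun k _ hk => hwr k (by omega))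
    (fun k _ hk => hstep k (by omega) (by omega))
  have hz2 := eq_zero_of_recursion (w := w) (a := ℓ + 1) (b := 2 * ℓ + 1) (r := min n ℓ) ρ
    (by omega) (fun k _ hk => hw0 k (by omega)) (fun k _ hk => hwr k (by omega))
    (fun k hk hk' => hstep k (by omega) (by omega))
  have hGz : ∀ k, G k = 0 := by
    intro k
    by_cases hk : k < 2 * ℓ + 2
    · refine LinearMap.pi_ext' fun i => LinearMap.ext_ring ?_
      simp only [LinearMap.comp_apply, LinearMap.coe_single, hw, LinearMap.zero_apply]
      rcases Nat.lt_or_ge ℓ k with h | h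
      · exact hz2 k h (by omega) i
      · exact hz1 k (Nat.zero_le _) h i
    · simp [G, hk]
  refine hg0 (LinearMap.prod_ext ?_ ?_)
  · refine LinearMap.pi_ext' fun k => ?_
    ext1 i
    have := hG k k.2
    simp only [hGz] at this
    refine LinearMap.ext fun ξ => ?_
    simpa using this _
  · refine LinearMap.ext fun ξ => ?_
    -- With all other components zero, the exceptional equation says that the functional vanishes on
    -- the prescribed coefficient too.
    have := hstate ℓ (by omega) ξ
    simp only [hGz, LinearMap.zero_apply, sub_zero, zero_add, if_true] at this
    simpa using this

variable {W : Type*} [AddCommGroup W] [Module ℝ W]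

theorem exists_polyFun_hasStateChains {sE sA : W → Matrix (Fin ℓ) (Fin n) 𝕜}
    {sB : W → Matrix (Fin ℓ) (Fin m) 𝕜} (hE : ∀ i j, (fun v => sE v i j) ∈ polyFun 𝕜 W)
    (hA : ∀ i j, (fun v => sA v i j) ∈ polyFun 𝕜 W)
    (hB : ∀ i j, (fun v => sB v i j) ∈ polyFun 𝕜 W) (ρ : 𝕜)
    (hℓ : 0 < ℓ) (hm : 0 < m) (hlt : ℓ < n + m) {v₁ : W} (hE₁ : sE v₁ = rectOne 𝕜 ℓ n)
    (hA₁ : sA v₁ = (skewTridiag 𝕜 ℓ - ρ • (1 : Matrix (Fin ℓ) (Fin ℓ) 𝕜)) * rectOne 𝕜 ℓ n)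
    (hB₁ : sB v₁ = controlMatrix 𝕜 ℓ n m) :
    ∃ f ∈ polyFun 𝕜 W, f v₁ ≠ 0 ∧ ∀ v, f v ≠ 0 → HasStateChains (sE v) (sA v) (sB v) := by
  have hΦ : ∀ z, IsPolyMap (𝕜 := 𝕜) fun v => stateMap (sE v) (sA v) (sB v) (2 * ℓ) ℓ z := by
    intro z
    refine isPolyMap_prod (isPolyMap_pi fun k => ?_) (isPolyMap_const _)
    refine IsPolyMap.sub (IsPolyMap.sub ?_ ?_) (isPolyMap_mulVec hB _)
    · split_ifs
      · exact isPolyMap_const _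
      · exact isPolyMap_mulVec hE _
    · split_ifs
      · exact isPolyMap_mulVec hA _
      · exact isPolyMap_const _
  obtain ⟨f, hf, hf₁, h⟩ := exists_polyFun_surjective (v₁ := v₁) _ hΦ (by
    simp only [hE₁, hA₁, hB₁]
    exact stateMap_reference_surjective ρ hℓ hm hlt)
  exact ⟨f, hf, hf₁, fun v hv => hasStateChains_of_surjective (by omega) (h v hv)⟩

end PortHamiltonian

namespace PortHamiltonian

variable {𝕜 : Type*} [RCLike 𝕜] {ℓ n m : ℕ}

/-! ### The reference systems without nonzero trajectories -/

/-- The input matrix of the overdetermined reference systems: unit vectors with indices beyond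
`n`. -/
def overMatrix (𝕜 : Type*) [RCLike 𝕜] (ℓ n m : ℕ) : Matrix (Fin ℓ) (Fin m) 𝕜 :=
  fun i c => if (i : ℕ) = n + 1 + c then 1 else 0

/-- The coefficients of `y(s) (s E - A)` and `y(s) B` for a polynomial row `y` of degree at most
`N`. -/
def rowMap (E A : Matrix (Fin ℓ) (Fin n) 𝕜) (B : Matrix (Fin ℓ) (Fin m) 𝕜) (N : ℕ) :
    (ℕ → Fin ℓ → 𝕜) →ₗ[𝕜] ((Fin (N + 2) → Fin n → 𝕜) × (Fin (N + 1) → Fin m → 𝕜)) where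
  toFun y := (fun k => (if (k : ℕ) = 0 then 0 else Eᵀ *ᵥ y (k - 1)) -
    (if (k : ℕ) ≤ N then Aᵀ *ᵥ y k else 0), fun k => Bᵀ *ᵥ y k)
  map_add' y y' := by
    refine Prod.ext (funext fun k => ?_) (funext fun k => ?_)
    · simp only [Prod.fst_add, Pi.add_apply, mulVec_add]
      split_ifs <;> abel
    · simp only [Prod.snd_add, Pi.add_apply, mulVec_add]
  map_smul' c y := by
    refine Prod.ext (funext fun k => ?_) (funext fun k => ?_)
    · simp only [Prod.smul_fst, Pi.smul_apply, mulVec_smul, RingHom.id_apply, smul_sub]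
      split_ifs <;> simp
    · simp only [Prod.smul_snd, Pi.smul_apply, mulVec_smul, RingHom.id_apply]

theorem hasRowChains_of_surjective {E A : Matrix (Fin ℓ) (Fin n) 𝕜}
    {B : Matrix (Fin ℓ) (Fin m) 𝕜} {N : ℕ}
    (h : Function.Surjective (rowMap E A B N)) : HasRowChains E A B := by
  intro p q
  obtain ⟨y, hy⟩ := h (Pi.single 0 p, Pi.single 0 q)
  have h1 : ∀ k : Fin (N + 2), (if (k : ℕ) = 0 then 0 else y (k - 1) ᵥ* E) -
      (if (k : ℕ) ≤ N then y k ᵥ* A else 0) =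
        (Pi.single 0 p : Fin (N + 2) → Fin n → 𝕜) k := fun k => by
    simpa only [← mulVec_transpose] using! congrFun (congrArg Prod.fst hy) k
  have h2 : ∀ k : Fin (N + 1), y k ᵥ* B = (Pi.single 0 q : Fin (N + 1) → Fin m → 𝕜) k :=
    fun k => by
      simpa only [← mulVec_transpose] using! congrFun (congrArg Prod.snd hy) k
  refine ⟨fun k => if k ≤ N then y k else 0, N + 1, fun k hk => if_neg (by omega), ?_, ?_,
    fun k => ?_, fun k => ?_⟩
  · have := h1 0
    simp only [Fin.val_zero, if_true, Nat.zero_le, zero_sub, Pi.single_eq_same] at this ⊢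
    rw [← this, neg_neg]
  · have := h2 0
    simpa using this
  · beta_reduce
    by_cases hk : k ≤ N
    · have := h1 ⟨k + 1, by omega⟩
      rw [Pi.single_eq_of_ne (by simp [Fin.ext_iff])] at this
      simp only [Nat.add_eq_zero_iff, one_ne_zero, and_false, if_false, Nat.add_sub_cancel] at this
      rw [if_pos hk, sub_eq_zero.1 this]
      split_ifs <;> simp
    · rw [if_neg hk, if_neg (by omega), zero_vecMul, zero_vecMul]
  · beta_reduce
    by_cases hk : k + 1 ≤ N
    · rw [if_pos hk]
      have := h2 ⟨k + 1, by omega⟩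
      rwa [Pi.single_eq_of_ne (by simp [Fin.ext_iff])] at this
    · rw [if_neg hk, zero_vecMul]

theorem rowMap_single (E A : Matrix (Fin ℓ) (Fin n) 𝕜) (B : Matrix (Fin ℓ) (Fin m) 𝕜)
    (N k : ℕ) (hk : k ≤ N) (ξ : Fin ℓ → 𝕜) :
    rowMap E A B N (Pi.single k ξ) =
      (Pi.single ⟨k + 1, by omega⟩ (Eᵀ *ᵥ ξ) - Pi.single ⟨k, by omega⟩ (Aᵀ *ᵥ ξ),
        Pi.single ⟨k, by omega⟩ (Bᵀ *ᵥ ξ)) := by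
  refine Prod.ext (funext fun j => ?_) (funext fun j => ?_)
  · simp only [rowMap, LinearMap.coe_mk, AddHom.coe_mk,
      Pi.sub_apply, Pi.single_apply, Fin.ext_iff]
    congr 1
    · by_cases h1 : (j : ℕ) = 0
      · rw [if_pos h1, if_neg (by omega)]
      · by_cases h2 : (j : ℕ) = k + 1
        · rw [if_neg h1, if_pos (by omega), if_pos h2]
        · rw [if_neg h1, if_neg (by omega), if_neg h2, mulVec_zero]
    · by_cases h2 : (j : ℕ) = k
      · rw [if_pos (by omega), if_pos h2, if_pos h2]
      · rw [if_neg h2, if_neg h2, mulVec_zero, ite_self]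
  · simp only [rowMap, LinearMap.coe_mk, AddHom.coe_mk, Pi.single_apply, Fin.ext_iff]
    by_cases h2 : (j : ℕ) = k
    · rw [if_pos h2, if_pos h2]
    · rw [if_neg h2, if_neg h2, mulVec_zero]

theorem apply_transpose_mulVec_single {p q : ℕ} (φ : (Fin q → 𝕜) →ₗ[𝕜] 𝕜)
    (M : Matrix (Fin p) (Fin q) 𝕜) (i : Fin p) :
    φ (Mᵀ *ᵥ Pi.single i 1) = ∑ j, M i j * φ (Pi.single j 1) := by
  conv_lhs => rw [LinearMap.pi_apply_eq_sum_univ φ]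
  refine Finset.sum_congr rfl fun j _ => ?_
  simp only [mulVec_single_one, col_apply, transpose_apply, smul_eq_mul]
  congr 2
  ext k
  simp [Pi.single_apply, eq_comm]

theorem sum_rectOne_mul (c : ℕ → 𝕜) (hc : ∀ j, n ≤ j → c j = 0) (i : Fin ℓ) :
    ∑ j : Fin n, rectOne 𝕜 ℓ n i j * c j = c i := by
  by_cases hi : (i : ℕ) < n
  · rw [Finset.sum_eq_single ⟨i, hi⟩]
    · simp [rectOne]
    · intro j _ hj
      have : ¬ (i : ℕ) = j := fun h => hj (Fin.ext h.symm)
      simp [rectOne, this]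
    · simp
  · rw [hc _ (not_lt.1 hi)]
    refine Finset.sum_eq_zero fun j _ => ?_
    have : ¬ (i : ℕ) = j := by omega
    simp [rectOne, this]

/-- Dually, an annihilating functional satisfies a tridiagonal recursion in the rows below `n`. Row
`n` is free of inputs and is zero in `E`, while in `A` it sees only the last state component, which
must therefore vanish. The recursion then runs from the last component down to the first, and the
rows from `n + 1` on kill the input part. -/
theorem rowMap_reference_surjective (ρ : 𝕜) (hn : 0 < n) (hlt : n + m < ℓ) :
    Function.Surjective (rowMap (rectOne 𝕜 ℓ n)
      ((skewTridiag 𝕜 ℓ - ρ • (1 : Matrix (Fin ℓ) (Fin ℓ) 𝕜)) * rectOne 𝕜 ℓ n)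
      (overMatrix 𝕜 ℓ n m) n) := by
  rw [← LinearMap.range_eq_top]
  by_contra hne
  obtain ⟨g, hg0, hg⟩ := Submodule.exists_le_ker_of_lt_top _ (lt_top_iff_ne_top.2 hne)
  have hgy : ∀ y, g (rowMap (rectOne 𝕜 ℓ n)
      ((skewTridiag 𝕜 ℓ - ρ • (1 : Matrix (Fin ℓ) (Fin ℓ) 𝕜)) * rectOne 𝕜 ℓ n)
      (overMatrix 𝕜 ℓ n m) n y) = 0 := fun y => hg ⟨y, rfl⟩
  let G : ℕ → (Fin n → 𝕜) →ₗ[𝕜] 𝕜 := fun k => if h : k < n + 2 then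
    g ∘ₗ LinearMap.inl 𝕜 _ _ ∘ₗ LinearMap.single 𝕜 (fun _ => Fin n → 𝕜) ⟨k, h⟩ else 0
  have hG : ∀ k (h : k < n + 2) ξ, g (Pi.single ⟨k, h⟩ ξ, 0) = G k ξ := by
    intro k h ξ
    simp [G, h]
  let H : ℕ → (Fin m → 𝕜) →ₗ[𝕜] 𝕜 := fun k => if h : k < n + 1 then
    g ∘ₗ LinearMap.inr 𝕜 _ _ ∘ₗ LinearMap.single 𝕜 (fun _ => Fin m → 𝕜) ⟨k, h⟩ else 0
  have hH : ∀ k (h : k < n + 1) ξ, g (0, Pi.single ⟨k, h⟩ ξ) = H k ξ := by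
    intro k h ξ
    simp only [H, dif_pos h]
    rfl
  let w : ℕ → ℕ → 𝕜 := fun k i => if h : i < n then G k (Pi.single ⟨i, h⟩ 1) else 0
  have hw : ∀ k (i : Fin n), G k (Pi.single i 1) = w k i := fun k i => by simp [w]
  have hwn : ∀ k i, n ≤ i → w k i = 0 := fun k i hi => by simp [w, hi]
  have hrow : ∀ k, k ≤ n → ∀ i : Fin ℓ, w (k + 1) i -
      (w k (i + 1) - (if 0 < (i : ℕ) then w k (i - 1) else 0) - ρ * w k i) +
      ∑ c, overMatrix 𝕜 ℓ n m i c * H k (Pi.single c 1) = 0 := by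
    intro k hk i
    have h1 := hgy (Pi.single k (Pi.single i 1))
    have h2 : ∀ a b c, g (a - b, c) = g (a, 0) - g (b, 0) + g (0, c) := fun a b c => by
      rw [← map_sub, ← map_add]
      simp
    rw [rowMap_single _ _ _ _ _ hk, h2, hG, hG, hH, apply_transpose_mulVec_single,
      apply_transpose_mulVec_single, apply_transpose_mulVec_single] at h1
    simp only [hw, sum_rectOne_mul _ (hwn _)] at h1
    have h3 : ∑ j : Fin n, ((skewTridiag 𝕜 ℓ - ρ • (1 : Matrix (Fin ℓ) (Fin ℓ) 𝕜)) *
        rectOne 𝕜 ℓ n) i j * w k j =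
        ∑ a, (skewTridiag 𝕜 ℓ - ρ • (1 : Matrix (Fin ℓ) (Fin ℓ) 𝕜)) i a * w k a := by
      simp only [Matrix.mul_apply, Finset.sum_mul]
      rw [Finset.sum_comm]
      refine Finset.sum_congr rfl fun a _ => ?_
      simp only [mul_assoc, ← Finset.mul_sum, sum_rectOne_mul _ (hwn _)]
    rw [h3, sum_reference_mul ρ (w k) (fun j hj => hwn k j (by omega))] at h1
    exact h1
  have hover : ∀ k (i : Fin ℓ), (i : ℕ) ≤ n →
      ∑ c, overMatrix 𝕜 ℓ n m i c * H k (Pi.single c 1) = 0 := by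
    intro k i hi
    refine Finset.sum_eq_zero fun c _ => ?_
    have : ¬ (i : ℕ) = n + 1 + c := by omega
    simp [overMatrix, this]
  have hlast : ∀ k, k ≤ n → w k (n - 1) = 0 := by
    intro k hk
    have h1 := hrow k hk ⟨n, by omega⟩
    rw [hover k _ le_rfl] at h1
    simpa [hwn, hn] using h1
  have hstep : ∀ k, k ≤ n → ∀ i, i < n → w (k + 1) i =
      w k (i + 1) - (if 0 < i then w k (i - 1) else 0) - ρ * w k i := by
    intro k hk i hi
    have h1 := hrow k hk ⟨i, by omega⟩
    rw [hover k _ hi.le, add_zero, sub_eq_zero] at h1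
    exact h1
  -- Reversing the order of the components by `i ↦ n - 1 - i` turns the known zero into component
  -- `0` and swaps the two neighbour terms to the signs required.
  have hz := eq_zero_of_recursion (w := fun k i => if i < n then w k (n - 1 - i) else 0)
    (a := 0) (b := n) (r := n) ρ (by omega)
    (fun k _ hk => by simpa [hn] using hlast k hk)
    (fun k _ hk i hi => if_neg (by omega))
    (fun k _ hk i hi => by
      rw [if_pos hi, if_pos hi, hstep k hk.le _ (by omega)]
      congr 2
      · by_cases h0 : 0 < i
        · rw [if_pos h0, if_pos (by omega)]
          congr 1
          omega
        · rw [if_neg h0, hwn _ _ (by omega)]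
      · by_cases h0 : i + 1 < n
        · rw [if_pos h0, if_pos (by omega)]
          congr 1
        · rw [if_neg h0, if_neg (by omega)])
  have hw0 : ∀ k, k ≤ n → ∀ i, w k i = 0 := by
    intro k hk i
    by_cases hi : i < n
    · have := hz k (Nat.zero_le _) hk (n - 1 - i)
      rw [if_pos (by omega)] at this
      rwa [show n - 1 - (n - 1 - i) = i by omega] at this
    · exact hwn k i (not_lt.1 hi)
  have hw1 : ∀ k, k ≤ n + 1 → ∀ i, w k i = 0 := by
    -- Equations up to time `n` involve components at time `n + 1`; one more step of the recursion
    -- covers them.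
    intro k hk i
    rcases Nat.lt_or_ge n k with h | h
    · obtain rfl : k = n + 1 := by omega
      by_cases hi : i < n
      · rw [hstep n le_rfl i hi]
        simp [hw0]
      · exact hwn _ i (not_lt.1 hi)
    · exact hw0 k h i
  have hHz : ∀ k, k ≤ n → ∀ c : Fin m, H k (Pi.single c 1) = 0 := by
    intro k hk c
    have h1 := hrow k hk ⟨n + 1 + c, by omega⟩
    simp only [hw1 k (by omega), hw1 (k + 1) (by omega), mul_zero, ite_self, sub_zero,
      zero_add] at h1
    rw [Finset.sum_eq_single c] at h1
    · simpa [overMatrix] using h1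
    · intro c' _ hc'
      have : ¬ (c : ℕ) = c' := fun h => hc' (Fin.ext h.symm)
      simp [overMatrix, this]
    · simp
  refine hg0 (LinearMap.prod_ext ?_ ?_)
  · refine LinearMap.pi_ext' fun k => LinearMap.pi_ext' fun i => LinearMap.ext_ring ?_
    have h1 := hG k k.2 (Pi.single i 1)
    rw [hw, hw1 k (by omega)] at h1
    simpa using h1
  · refine LinearMap.pi_ext' fun k => LinearMap.pi_ext' fun i => LinearMap.ext_ring ?_
    have h1 := hH k k.2 (Pi.single i 1)
    rw [hHz k (by omega)] at h1
    simpa using h1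

variable {W : Type*} [AddCommGroup W] [Module ℝ W]

theorem exists_polyFun_hasRowChains {sE sA : W → Matrix (Fin ℓ) (Fin n) 𝕜}
    {sB : W → Matrix (Fin ℓ) (Fin m) 𝕜} (hE : ∀ i j, (fun v => sE v i j) ∈ polyFun 𝕜 W)
    (hA : ∀ i j, (fun v => sA v i j) ∈ polyFun 𝕜 W)
    (hB : ∀ i j, (fun v => sB v i j) ∈ polyFun 𝕜 W) (ρ : 𝕜)
    (hn : 0 < n) (hlt : n + m < ℓ) {v₁ : W} (hE₁ : sE v₁ = rectOne 𝕜 ℓ n)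
    (hA₁ : sA v₁ = (skewTridiag 𝕜 ℓ - ρ • (1 : Matrix (Fin ℓ) (Fin ℓ) 𝕜)) * rectOne 𝕜 ℓ n)
    (hB₁ : sB v₁ = overMatrix 𝕜 ℓ n m) :
    ∃ f ∈ polyFun 𝕜 W, f v₁ ≠ 0 ∧
      ∀ v, f v ≠ 0 → HasRowChains (sE v) (sA v) (sB v) ∧ sE v ≠ 0 := by
  have hΦ : ∀ z, IsPolyMap (𝕜 := 𝕜) fun v => rowMap (sE v) (sA v) (sB v) n z := by
    intro z
    refine isPolyMap_prod (isPolyMap_pi fun k => ?_)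
      (isPolyMap_pi fun k => isPolyMap_mulVec (fun i j => hB j i) _)
    refine IsPolyMap.sub ?_ ?_
    · split_ifs
      · exact isPolyMap_const _
      · exact isPolyMap_mulVec (fun i j => hE j i) _
    · split_ifs
      · exact isPolyMap_mulVec (fun i j => hA j i) _
      · exact isPolyMap_const _
  obtain ⟨f, hf, hf₁, h⟩ := exists_polyFun_surjective (v₁ := v₁) _ hΦ (by
    simp only [hE₁, hA₁, hB₁]
    exact rowMap_reference_surjective ρ hn hlt)
  -- The extra factor, an entry of `E` equal to `1` at the reference system, guarantees `E ≠ 0`.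
  refine ⟨f * fun v => sE v ⟨0, by omega⟩ ⟨0, hn⟩, mul_mem hf (hE _ _), ?_, fun v hv => ?_⟩
  · simp [hf₁, hE₁, rectOne]
  · have hv := mul_ne_zero_iff.1 hv
    refine ⟨hasRowChains_of_surjective (h v hv.1), fun h0 => hv.2 ?_⟩
    simp [h0]

end PortHamiltonian

namespace PortHamiltonian

variable {𝕜 : Type*} [RCLike 𝕜] {ℓ n m : ℕ}

/-! ### Unstable reference systems -/

/-- The matrix `[E, B]` with its rows reindexed so that it becomes square. -/
def squareMatrix (e : Fin n ⊕ Fin m ≃ Fin ℓ) (E : Matrix (Fin ℓ) (Fin n) 𝕜)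
    (B : Matrix (Fin ℓ) (Fin m) 𝕜) : Matrix (Fin n ⊕ Fin m) (Fin n ⊕ Fin m) 𝕜 :=
  (fromCols E B).submatrix e id

/-- The real part of the trace of the state matrix of the system solved for `ẋ` and `u`, multiplied
by the squared modulus of `det [E, B]`. -/
noncomputable def traceIndicator (e : Fin n ⊕ Fin m ≃ Fin ℓ) (E A : Matrix (Fin ℓ) (Fin n) 𝕜)
    (B : Matrix (Fin ℓ) (Fin m) 𝕜) : ℝ :=
  RCLike.re (star (squareMatrix e E B).det *
    ((squareMatrix e E B).adjugate.submatrix Sum.inl e.symm * A).trace)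

/-- Positivity forces the determinant to be nonzero. The inverse is then the adjugate times the
conjugate determinant divided by its squared modulus, so the indicator is a positive multiple of the
real part of the trace of `L A`. -/
theorem exists_inverse_of_traceIndicator_pos {e : Fin n ⊕ Fin m ≃ Fin ℓ}
    {E A : Matrix (Fin ℓ) (Fin n) 𝕜} {B : Matrix (Fin ℓ) (Fin m) 𝕜}
    (h : 0 < traceIndicator e E A B) :
    ∃ (L : Matrix (Fin n) (Fin ℓ) 𝕜) (M : Matrix (Fin m) (Fin ℓ) 𝕜),
      L * E = 1 ∧ L * B = 0 ∧ E * L + B * M = 1 ∧ 0 < RCLike.re (L * A).trace := by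
  set T := squareMatrix e E B with hT
  have hd : T.det ≠ 0 := by
    intro h0
    simp [traceIndicator, ← hT, h0] at h
  set P := (T.det)⁻¹ • T.adjugate with hP
  have hPT : P * T = 1 := by
    rw [hP, Matrix.smul_mul, adjugate_mul, smul_smul, inv_mul_cancel₀ hd, one_smul]
  have hTP : T * P = 1 := mul_eq_one_comm.1 hPT
  have h1 : P.submatrix id e.symm * fromCols E B = 1 := by
    have : fromCols E B = T.submatrix e.symm id := by ext i j; simp [hT, squareMatrix]
    rw [this, submatrix_mul_equiv, hPT]
    simp
  have h2 : fromCols E B * P.submatrix id e.symm = 1 := by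
    have : fromCols E B = T.submatrix e.symm id := by ext i j; simp [hT, squareMatrix]
    rw [this, ← submatrix_mul _ _ _ _ _ Function.bijective_id, hTP]
    simp
  rw [← fromRows_toRows (P.submatrix id e.symm)] at h1 h2
  rw [fromRows_mul_fromCols, ← fromBlocks_one] at h1
  rw [fromCols_mul_fromRows] at h2
  obtain ⟨h3, h4, -, -⟩ := fromBlocks_inj.1 h1
  refine ⟨_, _, h3, h4, h2, ?_⟩
  have h5 : (P.submatrix id e.symm).toRows₁ = (T.det)⁻¹ • T.adjugate.submatrix Sum.inl e.symm := by
    ext i j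
    simp [hP]
  rw [h5, Matrix.smul_mul, trace_smul, smul_eq_mul]
  have h6 : (T.det)⁻¹ * (T.adjugate.submatrix Sum.inl e.symm * A).trace =
      (((RCLike.normSq T.det)⁻¹ : ℝ) : 𝕜) *
        (star T.det * (T.adjugate.submatrix Sum.inl e.symm * A).trace) := by
    rw [RCLike.inv_def, RCLike.normSq_eq_def', RCLike.star_def]
    push_cast
    ring
  rw [h6, RCLike.re_ofReal_mul]
  refine mul_pos (inv_pos.2 ?_) h
  rw [RCLike.normSq_eq_def']
  positivity

theorem traceIndicator_pos_of_inverse (e : Fin n ⊕ Fin m ≃ Fin ℓ)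
    {E A : Matrix (Fin ℓ) (Fin n) 𝕜} {B : Matrix (Fin ℓ) (Fin m) 𝕜}
    {L : Matrix (Fin n) (Fin ℓ) 𝕜} {M : Matrix (Fin m) (Fin ℓ) 𝕜}
    (hI : E * L + B * M = 1) (h : 0 < RCLike.re (L * A).trace) :
    0 < traceIndicator e E A B := by
  set T := squareMatrix e E B with hT
  have h1 : T * (fromRows L M).submatrix id e = 1 := by
    rw [hT, squareMatrix, ← submatrix_mul _ _ _ _ _ Function.bijective_id,
      fromCols_mul_fromRows, hI]
    simp
  have hd : T.det ≠ 0 := left_ne_zero_of_mul_eq_one (by rw [← det_mul, h1, det_one])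
  have h2 : T.adjugate = T.det • (fromRows L M).submatrix id e := by
    calc T.adjugate = T.adjugate * (T * (fromRows L M).submatrix id e) := by
          rw [h1, Matrix.mul_one]
      _ = _ := by rw [← Matrix.mul_assoc, adjugate_mul, Matrix.smul_mul, Matrix.one_mul]
  have h3 : T.adjugate.submatrix Sum.inl e.symm = T.det • L := by
    rw [h2]
    ext i j
    simp
  rw [traceIndicator, ← hT, h3, Matrix.smul_mul, trace_smul, smul_eq_mul, ← mul_assoc,
    RCLike.star_def, RCLike.conj_mul, ← RCLike.ofReal_pow, RCLike.re_ofReal_mul]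
  positivity

/-- The input matrix of the unstable reference systems. -/
def unstableMatrix (β : 𝕜) (ℓ n m : ℕ) : Matrix (Fin ℓ) (Fin m) 𝕜 :=
  fun i c => if (i : ℕ) = n + c then 1 else if (i : ℕ) + 1 = n ∧ (c : ℕ) = 0 then β else 0

/-- The inverse of `[E, B]` is explicit. The entry `β` makes `L` subtract `β` times row `n` of `A`
from row `n - 1`. Since the skew matrix has entry `-1` at `(n, n - 1)`, this adds `β` to one
diagonal entry and the trace becomes `β - n ρ`. -/
theorem traceIndicator_reference_pos (e : Fin n ⊕ Fin m ≃ Fin ℓ) (hℓ : ℓ = n + m) (hn : 0 < n)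
    (hm : 0 < m) (ρ β : ℝ) (hβ : n * ρ < β) :
    0 < traceIndicator e (rectOne 𝕜 ℓ n)
      ((skewTridiag 𝕜 ℓ - (ρ : 𝕜) • (1 : Matrix (Fin ℓ) (Fin ℓ) 𝕜)) * rectOne 𝕜 ℓ n)
      (unstableMatrix (β : 𝕜) ℓ n m) := by
  let L : Matrix (Fin n) (Fin ℓ) 𝕜 := fun i j => (if (j : ℕ) = i then 1 else 0) -
    if (i : ℕ) + 1 = n ∧ (j : ℕ) = n then (β : 𝕜) else 0
  let M : Matrix (Fin m) (Fin ℓ) 𝕜 := fun c j => if (j : ℕ) = n + c then 1 else 0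
  refine traceIndicator_pos_of_inverse e (L := L) (M := M) ?_ ?_
  · ext i j
    have h1 : (rectOne 𝕜 ℓ n * L) i j = if h : (i : ℕ) < n then L ⟨i, h⟩ j else 0 := by
      rw [Matrix.mul_apply]
      split_ifs with h
      · rw [Finset.sum_eq_single ⟨i, h⟩]
        · simp [rectOne]
        · intro b _ hb
          have : ¬ (i : ℕ) = b := fun h => hb (Fin.ext h.symm)
          simp [rectOne, this]
        · simp
      · refine Finset.sum_eq_zero fun b _ => ?_
        have : ¬ (i : ℕ) = b := by omega
        simp [rectOne, this]
    have h2 : (unstableMatrix (β : 𝕜) ℓ n m * M) i j = if h : n ≤ (j : ℕ) then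
        unstableMatrix (β : 𝕜) ℓ n m i ⟨j - n, by omega⟩ else 0 := by
      rw [Matrix.mul_apply]
      split_ifs with h
      · rw [Finset.sum_eq_single ⟨j - n, by omega⟩]
        · have : (j : ℕ) = n + (j - n) := by omega
          simp [M, ← this]
        · intro b _ hb
          have : ¬ (j : ℕ) = n + b := fun h => hb (Fin.ext (by simp; omega))
          simp [M, this]
        · simp
      · refine Finset.sum_eq_zero fun b _ => ?_
        have : ¬ (j : ℕ) = n + b := by omega
        simp [M, this]
    rw [Matrix.add_apply, h1, h2, Matrix.one_apply]
    simp only [L, unstableMatrix, Fin.ext_iff]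
    split_ifs <;> first | omega | simp
  · have h1 : ∀ (i : Fin n) (c : Fin ℓ → 𝕜), ∑ j, L i j * c j = c ⟨i, by omega⟩ -
        if (i : ℕ) + 1 = n then β * c ⟨n, by omega⟩ else 0 := by
      intro i c
      simp only [L, sub_mul, Finset.sum_sub_distrib]
      congr 1
      · rw [Finset.sum_eq_single ⟨i, by omega⟩]
        · simp
        · intro b _ hb
          have : ¬ (b : ℕ) = i := fun h => hb (Fin.ext h)
          simp [this]
        · simp
      · rw [Finset.sum_eq_single ⟨n, by omega⟩]
        · simp [ite_mul]
        · intro b _ hb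
          have : ¬ (b : ℕ) = n := fun h => hb (Fin.ext h)
          simp [this]
        · simp
    have h2 : ∀ (F : Matrix (Fin ℓ) (Fin ℓ) 𝕜) (j : Fin ℓ) (i : Fin n),
        (F * rectOne 𝕜 ℓ n) j i = F j ⟨i, by omega⟩ := by
      intro F j i
      rw [Matrix.mul_apply, Finset.sum_eq_single ⟨i, by omega⟩]
      · simp [rectOne]
      · intro b _ hb
        have : ¬ (b : ℕ) = i := fun h => hb (Fin.ext h)
        simp [rectOne, this]
      · simp
    have h3 : ∀ i : Fin n, (L * ((skewTridiag 𝕜 ℓ - (ρ : 𝕜) • (1 : Matrix (Fin ℓ) (Fin ℓ) 𝕜)) *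
        rectOne 𝕜 ℓ n)) i i = -(ρ : 𝕜) + if (i : ℕ) + 1 = n then (β : 𝕜) else 0 := by
      intro i
      rw [Matrix.mul_apply, h1 i]
      simp only [h2, Matrix.sub_apply, Matrix.smul_apply, Matrix.one_apply, skewTridiag,
        Fin.ext_iff, smul_eq_mul]
      split_ifs <;> first | omega | simp
    have h4 : (L * ((skewTridiag 𝕜 ℓ - (ρ : 𝕜) • (1 : Matrix (Fin ℓ) (Fin ℓ) 𝕜)) *
        rectOne 𝕜 ℓ n)).trace = ((β - n * ρ : ℝ) : 𝕜) := by
      simp only [Matrix.trace, Matrix.diag_apply, h3, Finset.sum_add_distrib]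
      rw [Finset.sum_eq_single (⟨n - 1, by omega⟩ : Fin n)
        (f := fun i : Fin n => if (i : ℕ) + 1 = n then (β : 𝕜) else 0)]
      · have : n - 1 + 1 = n := by omega
        simp [this]
        ring
      · intro b _ hb
        have : ¬ (b : ℕ) + 1 = n := fun h => hb (Fin.ext (by simp; omega))
        simp [this]
      · simp
    rw [h4, RCLike.ofReal_re]
    linarith

theorem continuous_traceIndicator {X : Type*} [TopologicalSpace X]
    (e : Fin n ⊕ Fin m ≃ Fin ℓ) {sE sA : X → Matrix (Fin ℓ) (Fin n) 𝕜}
    {sB : X → Matrix (Fin ℓ) (Fin m) 𝕜}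
    (hE : Continuous sE) (hA : Continuous sA) (hB : Continuous sB) :
    Continuous fun v => traceIndicator e (sE v) (sA v) (sB v) := by
  have hT : Continuous fun v => squareMatrix e (sE v) (sB v) := by
    refine continuous_matrix fun i j => ?_
    rcases j with j | j
    · exact hE.matrix_elem (e i) j
    · exact hB.matrix_elem (e i) j
  unfold traceIndicator
  refine RCLike.continuous_re.comp (hT.matrix_det.star.mul ?_)
  exact ((hT.matrix_adjugate.matrix_submatrix _ _).matrix_mul hA).matrix_trace

/-! ### Genericity for abstract parametrized families -/

section Family

variable {W : Type*} [AddCommGroup W] [Module ℝ W] [TopologicalSpace W]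
  [IsTopologicalAddGroup W] [ContinuousSMul ℝ W] [T2Space W] [FiniteDimensional ℝ W]

/-- The genericity statements for a polynomially parametrized family `V` of systems that contains
the reference systems with arbitrary input matrices, each of them joined by quadratic curves inside
`V` to the points of a dense subset of `V`. -/
theorem genericity_of_family {V : Set W} {sE sA : W → Matrix (Fin ℓ) (Fin n) 𝕜}
    {sB : W → Matrix (Fin ℓ) (Fin m) 𝕜} (hE : ∀ i j, (fun v => sE v i j) ∈ polyFun 𝕜 W)
    (hA : ∀ i j, (fun v => sA v i j) ∈ polyFun 𝕜 W)
    (hB : ∀ i j, (fun v => sB v i j) ∈ polyFun 𝕜 W) (ρ : ℝ)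
    (hV : ∀ B₁ : Matrix (Fin ℓ) (Fin m) 𝕜, ∃ v₁ ∈ V, sE v₁ = rectOne 𝕜 ℓ n ∧
      sA v₁ = (skewTridiag 𝕜 ℓ - (ρ : 𝕜) • (1 : Matrix (Fin ℓ) (Fin ℓ) 𝕜)) * rectOne 𝕜 ℓ n ∧
      sB v₁ = B₁ ∧ V ⊆ closure {v | ∃ c₁ c₂ : W, v + c₁ + c₂ = v₁ ∧
        ∀ t ∈ Set.Icc (0 : ℝ) 1, v + t • c₁ + t ^ 2 • c₂ ∈ V})
    (hℓ : 0 < ℓ) (hn : 0 < n) (hm : 0 < m) {S : SystemProperty 𝕜 ℓ n m → Set W}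
    (hS : ∀ P v, v ∈ S P ↔ v ∈ V ∧ P (sE v) (sA v) (sB v)) :
    (IsRelGeneric (S BehaviourallyStabilizable) V ↔ ℓ ≠ n + m) ∧
      (IsRelGeneric (S CompletelyStabilizable) V ↔ ℓ < n + m) ∧
      (IsRelGeneric (S StronglyStabilizable) V ↔ ℓ < n + m) ∧
      (ℓ > n + m →
        IsRelGeneric (S CompletelyStabilizable)ᶜ V ∧ IsRelGeneric (S StronglyStabilizable)ᶜ V) ∧
      (ℓ = n + m →
        HasNonemptyRelInterior (S BehaviourallyStabilizable)ᶜ V ∧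
        HasNonemptyRelInterior (S CompletelyStabilizable)ᶜ V ∧
        HasNonemptyRelInterior (S StronglyStabilizable)ᶜ V) := by
  have hne : V.Nonempty := by
    obtain ⟨v, hv, -⟩ := hV 0
    exact ⟨v, hv⟩
  have hlt : ℓ < n + m → IsRelGeneric (S BehaviourallyStabilizable) V ∧
      IsRelGeneric (S CompletelyStabilizable) V ∧ IsRelGeneric (S StronglyStabilizable) V := by
    intro h
    obtain ⟨v₁, hv₁, hE₁, hA₁, hB₁, hd⟩ := hV (controlMatrix 𝕜 ℓ n m)
    obtain ⟨f, hf, hf₁, hfc⟩ :=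
      exists_polyFun_hasStateChains hE hA hB (ρ : 𝕜) hℓ hm h hE₁ hA₁ hB₁
    have hdense := subset_closure_of_curves hf hf₁ hd
    exact ⟨isRelGeneric_of_polyFun hf
        (fun v hv h0 => (hS _ v).2 ⟨hv, (hfc v h0).behaviourallyStabilizable⟩) hdense,
      isRelGeneric_of_polyFun hf
        (fun v hv h0 => (hS _ v).2 ⟨hv, (hfc v h0).completelyStabilizable⟩) hdense,
      isRelGeneric_of_polyFun hf
        (fun v hv h0 => (hS _ v).2 ⟨hv, (hfc v h0).stronglyStabilizable⟩) hdense⟩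
  have hgt : n + m < ℓ → IsRelGeneric (S BehaviourallyStabilizable) V ∧
      IsRelGeneric (S CompletelyStabilizable)ᶜ V ∧
      IsRelGeneric (S StronglyStabilizable)ᶜ V := by
    intro h
    obtain ⟨v₁, hv₁, hE₁, hA₁, hB₁, hd⟩ := hV (overMatrix 𝕜 ℓ n m)
    obtain ⟨f, hf, hf₁, hfc⟩ :=
      exists_polyFun_hasRowChains hE hA hB (ρ : 𝕜) hn h hE₁ hA₁ hB₁
    have hdense := subset_closure_of_curves hf hf₁ hd
    exact ⟨isRelGeneric_of_polyFun hf
        (fun v hv h0 => (hS _ v).2 ⟨hv, (hfc v h0).1.behaviourallyStabilizable⟩) hdense,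
      isRelGeneric_of_polyFun hf
        (fun v _ h0 hmem => (hfc v h0).1.not_completelyStabilizable hn ((hS _ v).1 hmem).2) hdense,
      isRelGeneric_of_polyFun hf
        (fun v _ h0 hmem =>
          (hfc v h0).1.not_stronglyStabilizable (hfc v h0).2 ((hS _ v).1 hmem).2) hdense⟩
  have heq : ℓ = n + m → HasNonemptyRelInterior (S BehaviourallyStabilizable)ᶜ V ∧
        HasNonemptyRelInterior (S CompletelyStabilizable)ᶜ V ∧
        HasNonemptyRelInterior (S StronglyStabilizable)ᶜ V := by
    intro h
    -- With this `β` the trace of the state matrix is `1`.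
    obtain ⟨v₁, hv₁, hE₁, hA₁, hB₁, -⟩ := hV (unstableMatrix ((n * ρ + 1 : ℝ) : 𝕜) ℓ n m)
    let e : Fin n ⊕ Fin m ≃ Fin ℓ := finSumFinEquiv.trans (finCongr h.symm)
    have hpos : 0 < traceIndicator e (sE v₁) (sA v₁) (sB v₁) := by
      rw [hE₁, hA₁, hB₁]
      exact traceIndicator_reference_pos e h hn hm ρ _ (by linarith)
    have hc : Continuous fun v : V => traceIndicator e (sE v) (sA v) (sB v) :=
      (continuous_traceIndicator e
        (continuous_matrix fun i j => continuous_of_mem_polyFun (hE i j))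
        (continuous_matrix fun i j => continuous_of_mem_polyFun (hA i j))
        (continuous_matrix fun i j => continuous_of_mem_polyFun (hB i j))).comp
          continuous_subtype_val
    have hloc : ∀ {P : SystemProperty 𝕜 ℓ n m},
        (∀ v, 0 < traceIndicator e (sE v) (sA v) (sB v) → ¬ P (sE v) (sA v) (sB v)) →
        HasNonemptyRelInterior (S P)ᶜ V := by
      intro P hP
      refine ⟨⟨v₁, hv₁⟩, mem_interior.2 ⟨{v | 0 < traceIndicator e (sE v) (sA v) (sB v)},
        fun v hv hmem => hP v hv ((hS _ _).1 hmem).2, isOpen_lt continuous_const hc, hpos⟩⟩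
    refine ⟨hloc fun v hv => ?_, hloc fun v hv => ?_, hloc fun v hv => ?_⟩
    · obtain ⟨L, M, h1, h2, h3, h4⟩ := exists_inverse_of_traceIndicator_pos hv
      exact not_behaviourallyStabilizable_of_trace_pos h1 h2 h3 h4
    · obtain ⟨L, M, h1, h2, h3, h4⟩ := exists_inverse_of_traceIndicator_pos hv
      exact not_completelyStabilizable_of_trace_pos h1 h2 h4
    · obtain ⟨L, M, h1, h2, h3, h4⟩ := exists_inverse_of_traceIndicator_pos hv
      exact not_stronglyStabilizable_of_trace_pos h1 h2 h4
  refine ⟨⟨fun hg h => not_isRelGeneric_of_hasNonemptyRelInterior (heq h).1 hg, fun h => ?_⟩,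
    ⟨fun hg => ?_, fun h => (hlt h).2.1⟩, ⟨fun hg => ?_, fun h => (hlt h).2.2⟩,
    fun h => (hgt h).2, heq⟩
  · rcases lt_or_gt_of_ne h with h | h
    · exact (hlt h).1
    · exact (hgt h).1
  · by_contra hc
    rcases (not_lt.1 hc).eq_or_lt with h | h
    · exact not_isRelGeneric_of_hasNonemptyRelInterior (heq h.symm).2.1 hg
    · exact hg.not_compl hne (hgt h).2.1
  · by_contra hc
    rcases (not_lt.1 hc).eq_or_lt with h | h
    · exact not_isRelGeneric_of_hasNonemptyRelInterior (heq h.symm).2.2 hg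
    · exact hg.not_compl hne (hgt h).2.2

end Family

end PortHamiltonian

namespace PortHamiltonian

variable {𝕜 : Type*} [RCLike 𝕜] {ℓ n m : ℕ}

/-! ### Density of the systems with `Q = S E` -/

theorem exists_posSemidef_pseudoinverse {M : Matrix (Fin n) (Fin n) 𝕜} (hM : M.PosSemidef) :
    ∃ N : Matrix (Fin n) (Fin n) 𝕜, N.PosSemidef ∧ M * N * M = M := by
  set d := hM.1.eigenvalues
  set U : Matrix (Fin n) (Fin n) 𝕜 := ↑hM.1.eigenvectorUnitary
  have hU : Uᴴ * U = 1 := by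
    have := Unitary.coe_star_mul_self hM.1.eigenvectorUnitary
    rwa [star_eq_conjTranspose] at this
  have hspec : M = U * diagonal (fun i => (d i : 𝕜)) * Uᴴ := by
    have := hM.1.spectral_theorem
    rw [Unitary.conjStarAlgAut_apply] at this
    exact this
  -- The convention `0⁻¹ = 0` makes this the spectral pseudoinverse.
  refine ⟨U * diagonal (fun i => ((d i)⁻¹ : 𝕜)) * Uᴴ, ?_, ?_⟩
  · refine PosSemidef.mul_mul_conjTranspose_same (PosSemidef.diagonal fun i => ?_) U
    have : 0 ≤ (d i)⁻¹ := inv_nonneg.2 (hM.eigenvalues_nonneg i)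
    rw [← RCLike.ofReal_inv]
    exact RCLike.ofReal_nonneg.2 this
  · rw [hspec]
    calc U * diagonal (fun i => (d i : 𝕜)) * Uᴴ * (U * diagonal (fun i => ((d i)⁻¹ : 𝕜)) * Uᴴ) *
          (U * diagonal (fun i => (d i : 𝕜)) * Uᴴ)
        = U * diagonal (fun i => (d i : 𝕜)) * (Uᴴ * U) * diagonal (fun i => ((d i)⁻¹ : 𝕜)) *
          (Uᴴ * U) * diagonal (fun i => (d i : 𝕜)) * Uᴴ := by
          simp only [Matrix.mul_assoc]
      _ = U * diagonal (fun i => (d i : 𝕜)) * Uᴴ := by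
          rw [hU, Matrix.mul_one, Matrix.mul_one, Matrix.mul_assoc U, diagonal_mul_diagonal,
            Matrix.mul_assoc U, diagonal_mul_diagonal]
          congr 3
          ext i
          by_cases h : (d i : 𝕜) = 0
          · simp [h]
          · field_simp

theorem posSemidef_add_smul_mul {E Q : Matrix (Fin ℓ) (Fin n) 𝕜} (hEQ : (Eᴴ * Q).PosSemidef)
    {ε : ℝ} (hε : 0 ≤ ε) : ((E + ε • Q)ᴴ * Q).PosSemidef := by
  have h : (E + ε • Q)ᴴ * Q = Eᴴ * Q + ε • (Qᴴ * Q) := by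
    rw [conjTranspose_add, conjTranspose_smul, Matrix.add_mul, Matrix.smul_mul, star_trivial]
  rw [h]
  exact hEQ.add ((posSemidef_conjTranspose_mul_self Q).smul hε)

/-- For `E' = E + ε Q` the matrix `M = E'ᴴ Q = Eᴴ Q + ε Qᴴ Q` is a sum of positive semidefinite
terms, so its kernel lies in that of `Q`. With a pseudoinverse `N` of `M`, the choice `S = Q N Qᴴ`
gives `S E' = Q N M = Q`. -/
theorem exists_posSemidef_mul_eq {E Q : Matrix (Fin ℓ) (Fin n) 𝕜} (hEQ : (Eᴴ * Q).PosSemidef)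
    {ε : ℝ} (hε : 0 < ε) :
    ∃ S : Matrix (Fin ℓ) (Fin ℓ) 𝕜, S.PosSemidef ∧ Q = S * (E + ε • Q) := by
  have hM := posSemidef_add_smul_mul hEQ hε.le
  obtain ⟨N, hN, hMN⟩ := exists_posSemidef_pseudoinverse hM
  set M := (E + ε • Q)ᴴ * Q with hMdef
  refine ⟨Q * N * Qᴴ, hN.mul_mul_conjTranspose_same Q, ?_⟩
  have hM' : Qᴴ * (E + ε • Q) = M := by
    rw [← hM.1.eq, hMdef, conjTranspose_mul, conjTranspose_conjTranspose]
  rw [Matrix.mul_assoc, hM', Matrix.mul_assoc]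
  set X := 1 - N * M with hX
  have hMX : M * X = 0 := by
    rw [hX, Matrix.mul_sub, Matrix.mul_one, ← Matrix.mul_assoc, hMN, sub_self]
  -- Both summands have nonnegative trace, so `Q X` has zero Frobenius norm.
  have h1 : Xᴴ * (Eᴴ * Q) * X + ε • ((Q * X)ᴴ * (Q * X)) = 0 := by
    have : Xᴴ * (M * X) = 0 := by rw [hMX, Matrix.mul_zero]
    rw [← this, hMdef, conjTranspose_add, conjTranspose_smul, star_trivial, conjTranspose_mul]
    simp only [Matrix.add_mul, Matrix.mul_add, Matrix.smul_mul, Matrix.mul_smul, Matrix.mul_assoc]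
  have h2 := congrArg (fun Y => RCLike.re (trace Y)) h1
  simp only [trace_add, trace_smul, map_add, trace_zero, RCLike.zero_re, RCLike.smul_re] at h2
  have h3 : 0 ≤ RCLike.re (trace (Xᴴ * (Eᴴ * Q) * X)) :=
    (RCLike.nonneg_iff.1 (hEQ.conjTranspose_mul_mul_same X).trace_nonneg).1
  have h4 := RCLike.nonneg_iff.1 (posSemidef_conjTranspose_mul_self (Q * X)).trace_nonneg
  have h5 : RCLike.re (trace ((Q * X)ᴴ * (Q * X))) = 0 := by nlinarith [h4.1]
  have h6 : trace ((Q * X)ᴴ * (Q * X)) = 0 := RCLike.ext (by simpa using h5) (by simpa using h4.2)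
  have h7 : Q * X = 0 := trace_conjTranspose_mul_self_eq_zero_iff.1 h6
  rw [hX, Matrix.mul_sub, Matrix.mul_one, sub_eq_zero] at h7
  exact h7

/-- The quadratic curve `Q = S E` with `E` and `S` moving on line segments. -/
theorem curve_posSemidef {E E₁ : Matrix (Fin ℓ) (Fin n) 𝕜} {S : Matrix (Fin ℓ) (Fin ℓ) 𝕜}
    (hS : S.PosSemidef) {t : ℝ} (ht : t ∈ Set.Icc (0 : ℝ) 1) :
    ((E + t • (E₁ - E))ᴴ * (S * E + t • ((1 - S) * E + S * (E₁ - E)) +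
      t ^ 2 • ((1 - S) * (E₁ - E)))).PosSemidef := by
  -- The factor `S` moves along the segment to `1`, so that `Q = E = E₁` at the end of the curve.
  have hSt : (S + t • (1 - S)).PosSemidef := by
    have h1 : S + t • (1 - S) = (1 - t) • S + t • (1 : Matrix (Fin ℓ) (Fin ℓ) 𝕜) := by
      module
    rw [h1]
    exact (hS.smul (sub_nonneg.2 ht.2)).add (PosSemidef.one.smul ht.1)
  have h2 : S * E + t • ((1 - S) * E + S * (E₁ - E)) + t ^ 2 • ((1 - S) * (E₁ - E)) =
      (S + t • (1 - S)) * (E + t • (E₁ - E)) := by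
    simp only [Matrix.add_mul, Matrix.mul_add, Matrix.smul_mul, Matrix.mul_smul, smul_smul,
      smul_add, pow_two]
    abel
  rw [h2, ← Matrix.mul_assoc]
  exact hSt.conjTranspose_mul_mul_same _

theorem skew_curve {J J₁ : Matrix (Fin ℓ) (Fin ℓ) 𝕜} (hJ : J = -Jᴴ) (hJ₁ : J₁ = -J₁ᴴ) (t : ℝ) :
    J + t • (J₁ - J) = -(J + t • (J₁ - J))ᴴ := by
  rw [conjTranspose_add, conjTranspose_smul, conjTranspose_sub, star_trivial]
  nth_rewrite 1 [hJ, hJ₁]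
  nth_rewrite 2 [hJ]
  module

theorem convex_posSemidef : Convex ℝ {R : Matrix (Fin ℓ) (Fin ℓ) 𝕜 | R.PosSemidef} :=
  fun _ hx _ hy _ _ ha hb _ => (PosSemidef.smul hx ha).add (PosSemidef.smul hy hb)

theorem convex_posDef : Convex ℝ {R : Matrix (Fin ℓ) (Fin ℓ) 𝕜 | R.PosDef} := by
  intro x hx y hy a b ha hb hab
  rcases ha.eq_or_lt with rfl | ha
  · obtain rfl : b = 1 := by linarith
    simpa using hy
  · exact (PosDef.smul hx ha).add_posSemidef (PosSemidef.smul (PosDef.posSemidef hy) hb)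

theorem isHermitian_mul_of_posSemidef {E Q : Matrix (Fin ℓ) (Fin n) 𝕜}
    (h : (Eᴴ * Q).PosSemidef) : Eᴴ * Q = Qᴴ * E := by
  rw [← h.1.eq, conjTranspose_mul, conjTranspose_conjTranspose]

theorem skewTridiag_eq_neg : skewTridiag 𝕜 ℓ = -(skewTridiag 𝕜 ℓ)ᴴ := by
  rw [skewTridiag_conjTranspose, neg_neg]

theorem tendsto_add_smul {E Q : Matrix (Fin ℓ) (Fin n) 𝕜} :
    Tendsto (fun ε : ℝ => E + ε • Q) (𝓝[>] 0) (𝓝 E) := by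
  have hc : Continuous fun ε : ℝ => E + ε • Q := by fun_prop
  simpa using (hc.tendsto 0).mono_left (nhdsWithin_le_nhds (s := Set.Ioi 0))

/-- The point is approximated by `E + ε Q`, which has the form required for the quadratic curve; `J`
and `B` move on segments, and only `Q` needs a quadratic term. -/
theorem sigmaH_subset_closure (B₁ : Matrix (Fin ℓ) (Fin m) 𝕜) :
    SigmaH 𝕜 ℓ n m ⊆ closure {v | ∃ c₁ c₂ : Quadruple 𝕜 ℓ n m,
      v + c₁ + c₂ = (rectOne 𝕜 ℓ n, skewTridiag 𝕜 ℓ, rectOne 𝕜 ℓ n, B₁) ∧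
      ∀ t ∈ Set.Icc (0 : ℝ) 1, v + t • c₁ + t ^ 2 • c₂ ∈ SigmaH 𝕜 ℓ n m} := by
  rintro ⟨E, J, Q, B⟩ ⟨hJ, -, hEQ⟩
  refine mem_closure_of_tendsto (f := fun ε : ℝ => (E + ε • Q, J, Q, B)) (b := 𝓝[>] 0)
    (tendsto_add_smul.prodMk_nhds tendsto_const_nhds) ?_
  filter_upwards [self_mem_nhdsWithin] with ε hε
  obtain ⟨S, hS, hQ⟩ := exists_posSemidef_mul_eq hEQ hε
  generalize E + ε • Q = E' at hQ
  subst hQ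
  refine ⟨(rectOne 𝕜 ℓ n - E', skewTridiag 𝕜 ℓ - J,
    (1 - S) * E' + S * (rectOne 𝕜 ℓ n - E'), B₁ - B),
    (0, 0, (1 - S) * (rectOne 𝕜 ℓ n - E'), 0), ?_, fun t ht => ?_⟩
  · refine Prod.ext ?_ (Prod.ext ?_ (Prod.ext ?_ ?_))
    · simp
    · simp
    · simp only [Prod.snd_add, Prod.fst_add, Matrix.mul_sub, Matrix.sub_mul, Matrix.one_mul]
      abel
    · simp
  · have h := curve_posSemidef (E := E') (E₁ := rectOne 𝕜 ℓ n) hS ht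
    refine ⟨?_, ?_, ?_⟩
    · simpa using skew_curve hJ skewTridiag_eq_neg t
    · simpa using isHermitian_mul_of_posSemidef h
    · simpa using h

/-- The semidefinite and the definite case are treated together: the segment from `R` to `1` stays
in `C` by convexity. -/
theorem dissipative_subset_closure {C : Set (Matrix (Fin ℓ) (Fin ℓ) 𝕜)} (hC : Convex ℝ C)
    (h1 : 1 ∈ C) {V : Set (Quintuple 𝕜 ℓ n m)} (hV : ∀ E J R Q B, (E, J, R, Q, B) ∈ V ↔
      J = -Jᴴ ∧ R ∈ C ∧ Eᴴ * Q = Qᴴ * E ∧ (Eᴴ * Q).PosSemidef) (B₁ : Matrix (Fin ℓ) (Fin m) 𝕜) :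
    V ⊆ closure {v | ∃ c₁ c₂ : Quintuple 𝕜 ℓ n m,
      v + c₁ + c₂ = (rectOne 𝕜 ℓ n, skewTridiag 𝕜 ℓ, 1, rectOne 𝕜 ℓ n, B₁) ∧
      ∀ t ∈ Set.Icc (0 : ℝ) 1, v + t • c₁ + t ^ 2 • c₂ ∈ V} := by
  rintro ⟨E, J, R, Q, B⟩ hmem
  obtain ⟨hJ, hR, -, hEQ⟩ := (hV E J R Q B).1 hmem
  refine mem_closure_of_tendsto (f := fun ε : ℝ => (E + ε • Q, J, R, Q, B)) (b := 𝓝[>] 0)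
    (tendsto_add_smul.prodMk_nhds tendsto_const_nhds) ?_
  filter_upwards [self_mem_nhdsWithin] with ε hε
  obtain ⟨S, hS, hQ⟩ := exists_posSemidef_mul_eq hEQ hε
  clear hmem
  generalize E + ε • Q = E' at hQ
  subst hQ
  refine ⟨(rectOne 𝕜 ℓ n - E', skewTridiag 𝕜 ℓ - J, 1 - R,
    (1 - S) * E' + S * (rectOne 𝕜 ℓ n - E'), B₁ - B),
    (0, 0, 0, (1 - S) * (rectOne 𝕜 ℓ n - E'), 0), ?_, fun t ht => ?_⟩
  · refine Prod.ext ?_ (Prod.ext ?_ (Prod.ext ?_ (Prod.ext ?_ ?_)))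
    · simp
    · simp
    · simp
    · simp only [Prod.snd_add, Prod.fst_add, Matrix.mul_sub, Matrix.sub_mul, Matrix.one_mul]
      abel
    · simp
  · have h := curve_posSemidef (E := E') (E₁ := rectOne 𝕜 ℓ n) hS ht
    refine (hV _ _ _ _ _).2 ⟨?_, ?_, ?_, ?_⟩
    · simpa using skew_curve hJ skewTridiag_eq_neg t
    · simpa using hC.add_smul_sub_mem hR h1 ht
    · simpa using isHermitian_mul_of_posSemidef h
    · simpa using h

/-! ### Genericity for port-Hamiltonian systems -/

theorem entry_mem_polyFun {W : Type*} [AddCommGroup W] [Module ℝ W]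
    {f : W → Matrix (Fin ℓ) (Fin n) 𝕜} (hf : IsLinearMap ℝ f) (i : Fin ℓ) (j : Fin n) :
    (fun v => f v i j) ∈ polyFun 𝕜 W :=
  linear_mem_polyFun (Matrix.entryLinearMap ℝ 𝕜 i j ∘ₗ hf.mk' f)

instance finiteDimensional_quadruple : FiniteDimensional ℝ (Quadruple 𝕜 ℓ n m) :=
  have := Module.Finite.prod (R := ℝ) (M := Matrix (Fin ℓ) (Fin n) 𝕜)
    (N := Matrix (Fin ℓ) (Fin m) 𝕜)
  have := Module.Finite.prod (R := ℝ) (M := Matrix (Fin ℓ) (Fin ℓ) 𝕜)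
    (N := Matrix (Fin ℓ) (Fin n) 𝕜 × Matrix (Fin ℓ) (Fin m) 𝕜)
  Module.Finite.prod

instance finiteDimensional_quintuple : FiniteDimensional ℝ (Quintuple 𝕜 ℓ n m) :=
  have := Module.Finite.prod (R := ℝ) (M := Matrix (Fin ℓ) (Fin n) 𝕜)
    (N := Matrix (Fin ℓ) (Fin m) 𝕜)
  have := Module.Finite.prod (R := ℝ) (M := Matrix (Fin ℓ) (Fin ℓ) 𝕜)
    (N := Matrix (Fin ℓ) (Fin n) 𝕜 × Matrix (Fin ℓ) (Fin m) 𝕜)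
  have := Module.Finite.prod (R := ℝ) (M := Matrix (Fin ℓ) (Fin ℓ) 𝕜)
    (N := Matrix (Fin ℓ) (Fin ℓ) 𝕜 × Matrix (Fin ℓ) (Fin n) 𝕜 × Matrix (Fin ℓ) (Fin m) 𝕜)
  Module.Finite.prod

theorem mul_mem_polyFun {W : Type*} [AddCommGroup W] [Module ℝ W]
    {F : W → Matrix (Fin ℓ) (Fin ℓ) 𝕜} {Q : W → Matrix (Fin ℓ) (Fin n) 𝕜}
    (hF : ∀ i j, (fun v => F v i j) ∈ polyFun 𝕜 W) (hQ : ∀ i j, (fun v => Q v i j) ∈ polyFun 𝕜 W)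
    (i : Fin ℓ) (j : Fin n) : (fun v => (F v * Q v) i j) ∈ polyFun 𝕜 W := by
  have : (fun v => (F v * Q v) i j) = ∑ k, (fun v => F v i k) * fun v => Q v k j := by
    ext v
    simp [Matrix.mul_apply]
  rw [this]
  exact Subalgebra.sum_mem _ fun k _ => mul_mem (hF i k) (hQ k j)

theorem dissipative_genericity {C : Set (Matrix (Fin ℓ) (Fin ℓ) 𝕜)} (hC : Convex ℝ C)
    (h1 : 1 ∈ C) {V : Set (Quintuple 𝕜 ℓ n m)} (hV : ∀ E J R Q B, (E, J, R, Q, B) ∈ V ↔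
      J = -Jᴴ ∧ R ∈ C ∧ Eᴴ * Q = Qᴴ * E ∧ (Eᴴ * Q).PosSemidef)
    (hℓ : 0 < ℓ) (hn : 0 < n) (hm : 0 < m)
    {S : SystemProperty 𝕜 ℓ n m → Set (Quintuple 𝕜 ℓ n m)}
    (hS : ∀ P v, v ∈ S P ↔ v ∈ V ∧ P v.1 ((v.2.1 - v.2.2.1) * v.2.2.2.1) v.2.2.2.2) :
    (IsRelGeneric (S BehaviourallyStabilizable) V ↔ ℓ ≠ n + m) ∧
      (IsRelGeneric (S CompletelyStabilizable) V ↔ ℓ < n + m) ∧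
      (IsRelGeneric (S StronglyStabilizable) V ↔ ℓ < n + m) ∧
      (ℓ > n + m →
        IsRelGeneric (S CompletelyStabilizable)ᶜ V ∧ IsRelGeneric (S StronglyStabilizable)ᶜ V) ∧
      (ℓ = n + m →
        HasNonemptyRelInterior (S BehaviourallyStabilizable)ᶜ V ∧
        HasNonemptyRelInterior (S CompletelyStabilizable)ᶜ V ∧
        HasNonemptyRelInterior (S StronglyStabilizable)ᶜ V) := by
  have hE : ∀ i j, (fun v : Quintuple 𝕜 ℓ n m => v.1 i j) ∈ polyFun 𝕜 (Quintuple 𝕜 ℓ n m) :=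
    entry_mem_polyFun (f := fun v : Quintuple 𝕜 ℓ n m => v.1) ⟨fun _ _ => rfl, fun _ _ => rfl⟩
  have hQ : ∀ i j, (fun v : Quintuple 𝕜 ℓ n m => v.2.2.2.1 i j) ∈
      polyFun 𝕜 (Quintuple 𝕜 ℓ n m) :=
    entry_mem_polyFun (f := fun v : Quintuple 𝕜 ℓ n m => v.2.2.2.1) ⟨fun _ _ => rfl, fun _ _ => rfl⟩
  have hB : ∀ i j, (fun v : Quintuple 𝕜 ℓ n m => v.2.2.2.2 i j) ∈
      polyFun 𝕜 (Quintuple 𝕜 ℓ n m) :=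
    entry_mem_polyFun (f := fun v : Quintuple 𝕜 ℓ n m => v.2.2.2.2) ⟨fun _ _ => rfl, fun _ _ => rfl⟩
  have hF : ∀ i j, (fun v : Quintuple 𝕜 ℓ n m => (v.2.1 - v.2.2.1) i j) ∈
      polyFun 𝕜 (Quintuple 𝕜 ℓ n m) :=
    entry_mem_polyFun (f := fun v : Quintuple 𝕜 ℓ n m => v.2.1 - v.2.2.1)
      ⟨fun _ _ => add_sub_add_comm _ _ _ _, fun _ _ => (smul_sub _ _ _).symm⟩
  have hA : ∀ i j, (fun v : Quintuple 𝕜 ℓ n m => ((v.2.1 - v.2.2.1) * v.2.2.2.1) i j) ∈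
      polyFun 𝕜 (Quintuple 𝕜 ℓ n m) :=
    mul_mem_polyFun (F := fun v : Quintuple 𝕜 ℓ n m => v.2.1 - v.2.2.1)
      (Q := fun v : Quintuple 𝕜 ℓ n m => v.2.2.2.1) hF hQ
  -- The reference system has `R = 1`, hence `ρ = 1`.
  refine genericity_of_family (sE := fun v : Quintuple 𝕜 ℓ n m => v.1)
    (sA := fun v : Quintuple 𝕜 ℓ n m => (v.2.1 - v.2.2.1) * v.2.2.2.1)
    (sB := fun v : Quintuple 𝕜 ℓ n m => v.2.2.2.2) hE hA hB 1 (fun B₁ => ?_) hℓ hn hm hS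
  exact ⟨(rectOne 𝕜 ℓ n, skewTridiag 𝕜 ℓ, 1, rectOne 𝕜 ℓ n, B₁),
    (hV _ _ _ _ _).2 ⟨skewTridiag_eq_neg, h1, rfl, posSemidef_conjTranspose_mul_self _⟩,
    rfl, by simp, rfl, dissipative_subset_closure hC h1 hV B₁⟩

end PortHamiltonian

theorem mainTheorem2 (𝕜 : Type*) [RCLike 𝕜] (ℓ n m : ℕ)
    (hℓ : 0 < ℓ) (hn : 0 < n) (hm : 0 < m) :
    ((IsRelGeneric (setH BehaviourallyStabilizable) (SigmaH 𝕜 ℓ n m) ↔ ℓ ≠ n + m) ∧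
      (IsRelGeneric (setH CompletelyStabilizable) (SigmaH 𝕜 ℓ n m) ↔ ℓ < n + m) ∧
      (IsRelGeneric (setH StronglyStabilizable) (SigmaH 𝕜 ℓ n m) ↔ ℓ < n + m) ∧
      (ℓ > n + m →
        IsRelGeneric (setH CompletelyStabilizable)ᶜ (SigmaH 𝕜 ℓ n m) ∧
        IsRelGeneric (setH StronglyStabilizable)ᶜ (SigmaH 𝕜 ℓ n m)) ∧
      (ℓ = n + m →
        HasNonemptyRelInterior (setH BehaviourallyStabilizable)ᶜ (SigmaH 𝕜 ℓ n m) ∧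
        HasNonemptyRelInterior (setH CompletelyStabilizable)ᶜ (SigmaH 𝕜 ℓ n m) ∧
        HasNonemptyRelInterior (setH StronglyStabilizable)ᶜ (SigmaH 𝕜 ℓ n m))) ∧
    ((IsRelGeneric (setSDH BehaviourallyStabilizable) (SigmaSDH 𝕜 ℓ n m) ↔ ℓ ≠ n + m) ∧
      (IsRelGeneric (setSDH CompletelyStabilizable) (SigmaSDH 𝕜 ℓ n m) ↔ ℓ < n + m) ∧
      (IsRelGeneric (setSDH StronglyStabilizable) (SigmaSDH 𝕜 ℓ n m) ↔ ℓ < n + m) ∧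
      (ℓ > n + m →
        IsRelGeneric (setSDH CompletelyStabilizable)ᶜ (SigmaSDH 𝕜 ℓ n m) ∧
        IsRelGeneric (setSDH StronglyStabilizable)ᶜ (SigmaSDH 𝕜 ℓ n m)) ∧
      (ℓ = n + m →
        HasNonemptyRelInterior (setSDH BehaviourallyStabilizable)ᶜ (SigmaSDH 𝕜 ℓ n m) ∧
        HasNonemptyRelInterior (setSDH CompletelyStabilizable)ᶜ (SigmaSDH 𝕜 ℓ n m) ∧
        HasNonemptyRelInterior (setSDH StronglyStabilizable)ᶜ (SigmaSDH 𝕜 ℓ n m))) ∧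
    ((IsRelGeneric (setDH BehaviourallyStabilizable) (SigmaDH 𝕜 ℓ n m) ↔ ℓ ≠ n + m) ∧
      (IsRelGeneric (setDH CompletelyStabilizable) (SigmaDH 𝕜 ℓ n m) ↔ ℓ < n + m) ∧
      (IsRelGeneric (setDH StronglyStabilizable) (SigmaDH 𝕜 ℓ n m) ↔ ℓ < n + m) ∧
      (ℓ > n + m →
        IsRelGeneric (setDH CompletelyStabilizable)ᶜ (SigmaDH 𝕜 ℓ n m) ∧
        IsRelGeneric (setDH StronglyStabilizable)ᶜ (SigmaDH 𝕜 ℓ n m)) ∧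
      (ℓ = n + m →
        HasNonemptyRelInterior (setDH BehaviourallyStabilizable)ᶜ (SigmaDH 𝕜 ℓ n m) ∧
        HasNonemptyRelInterior (setDH CompletelyStabilizable)ᶜ (SigmaDH 𝕜 ℓ n m) ∧
        HasNonemptyRelInterior (setDH StronglyStabilizable)ᶜ (SigmaDH 𝕜 ℓ n m))) := by
  refine ⟨?_, ?_, ?_⟩
  · have hE : ∀ i j, (fun v : Quadruple 𝕜 ℓ n m => v.1 i j) ∈ polyFun 𝕜 (Quadruple 𝕜 ℓ n m) :=
      entry_mem_polyFun (f := fun v : Quadruple 𝕜 ℓ n m => v.1) ⟨fun _ _ => rfl, fun _ _ => rfl⟩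
    have hJ : ∀ i j, (fun v : Quadruple 𝕜 ℓ n m => v.2.1 i j) ∈ polyFun 𝕜 (Quadruple 𝕜 ℓ n m) :=
      entry_mem_polyFun (f := fun v : Quadruple 𝕜 ℓ n m => v.2.1) ⟨fun _ _ => rfl, fun _ _ => rfl⟩
    have hQ : ∀ i j, (fun v : Quadruple 𝕜 ℓ n m => v.2.2.1 i j) ∈
        polyFun 𝕜 (Quadruple 𝕜 ℓ n m) :=
      entry_mem_polyFun (f := fun v : Quadruple 𝕜 ℓ n m => v.2.2.1) ⟨fun _ _ => rfl, fun _ _ => rfl⟩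
    have hB : ∀ i j, (fun v : Quadruple 𝕜 ℓ n m => v.2.2.2 i j) ∈
        polyFun 𝕜 (Quadruple 𝕜 ℓ n m) :=
      entry_mem_polyFun (f := fun v : Quadruple 𝕜 ℓ n m => v.2.2.2) ⟨fun _ _ => rfl, fun _ _ => rfl⟩
    have hA : ∀ i j, (fun v : Quadruple 𝕜 ℓ n m => (v.2.1 * v.2.2.1) i j) ∈
        polyFun 𝕜 (Quadruple 𝕜 ℓ n m) :=
      mul_mem_polyFun (F := fun v : Quadruple 𝕜 ℓ n m => v.2.1)
        (Q := fun v : Quadruple 𝕜 ℓ n m => v.2.2.1) hJ hQ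
    -- Without dissipation the reference system has `ρ = 0`.
    refine genericity_of_family (sE := fun v : Quadruple 𝕜 ℓ n m => v.1)
      (sA := fun v : Quadruple 𝕜 ℓ n m => v.2.1 * v.2.2.1)
      (sB := fun v : Quadruple 𝕜 ℓ n m => v.2.2.2) hE hA hB 0 (fun B₁ => ?_)
      hℓ hn hm (fun P v => Iff.rfl)
    exact ⟨(rectOne 𝕜 ℓ n, skewTridiag 𝕜 ℓ, rectOne 𝕜 ℓ n, B₁),
      ⟨skewTridiag_eq_neg, rfl, posSemidef_conjTranspose_mul_self _⟩,
      rfl, by simp, rfl, sigmaH_subset_closure B₁⟩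
  · exact dissipative_genericity convex_posSemidef PosSemidef.one (fun _ _ _ _ _ => Iff.rfl)
      hℓ hn hm (fun P v => Iff.rfl)
  · exact dissipative_genericity convex_posDef PosDef.one (fun _ _ _ _ _ => Iff.rfl)
      hℓ hn hm (fun P v => Iff.rfl)
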